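/- Let $H\in(2/3,1)$, let $\tilde a\in\mathbb R$, $\tilde\sigma>0$ and $x_0>0$, and let $B^H=(B^H_t)_{t\ge 0}$ be a fractional Brownian motion with Hurst index $H$ on a probability space, i.e. a centered Gaussian process with a.s. continuous paths and covariance $\mathsf E B^H_tB^H_s=\tfrac12\left(t^{2H}+s^{2H}-|t-s|^{2H}\right)$. Consider the equation $$X_t=x_0+\tilde a\int_0^tX_s\,ds+\tilde\sigma\int_0^t\sqrt{X_s}\,dB^H_s, \qquad (1)$$ where the last integral is required to exist pathwise as a Riemann–Stieltjes integral, i.e. as the limit, as the mesh of the partition tends to zero, of the sums $\sum_k\sqrt{X_{\xi_k}}\,(B^H_{t_{k+1}}-B^H_{t_k})$ over partitions $0=t_0\le t_1\le\dots\le t_n=t$ with arbitrary $\xi_k\in[t_k,t_{k+1}]$. For a process $Z=(Z_t)_{t\ge0}$ put $\tau_0(Z)=\inf\{t>0: Z_t=0\}$ (with $\inf\emptyset=\infty$). A process $X=(X_t)_{t\ge 0}$ with a.s. continuous paths is called a solution until hitting zero if, a.s., $X_0=x_0$ and (1) holds for all $t\in[0,\tau_0(X))$. A fractional Ornstein–Uhlenbeck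 (fOU) process here means a process $Y=(Y_t)_{t\ge 0}$ with a.s. continuous paths such that, a.s., $$Y_t=\sqrt{x_0}+\frac{\tilde a}{2}\int_0^tY_s\,ds+\frac{\tilde\sigma}{2}B^H_t\qquad\text{for all }t\ge0.$$ Then: 1. there is a process $X$ with a.s. continuous nonnegative paths and $X_0=x_0$ a.s. that a.s. satisfies (1) for all $t\ge0$; 2. solutions until hitting zero are unique: if $X$ and $X'$ are two of them, then a.s. $\tau_0(X)=\tau_0(X')$ and $X_t=X'_t$ for all $t\in[0,\tau_0(X))$; 3. the fOU process $Y$ exists; 4. if $X$ is a solution until hitting zero and $Y$ is an fOU process as above, then a.s. $\tau_0(X)=\tau_0(Y)$ and $X_t=Y_t^2$ for all $t\in[0,\tau_0(X))$. -/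

import Mathlib

open MeasureTheory ProbabilityTheory
open scoped NNReal ENNReal

namespace FCIR

/-- `B = (B_t)_{t ≥ 0}` is a fractional Brownian motion with Hurst index `H`: a centered Gaussian
process with covariance `E[B_t B_s] = (t^{2H} + s^{2H} - |t - s|^{2H}) / 2`, taken, as usual, with
almost surely continuous paths. -/
structure IsFBM {Ω : Type*} [MeasurableSpace Ω] (P : Measure Ω) (H : ℝ) (B : ℝ≥0 → Ω → ℝ) :
    Prop where
  gaussian : IsGaussianProcess B P
  centered : ∀ t, ∫ ω, B t ω ∂P = 0
  covariance : ∀ t s : ℝ≥0, ∫ ω, B t ω * B s ω ∂P =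
    (1 / 2) * ((t : ℝ) ^ (2 * H) + (s : ℝ) ^ (2 * H) - |(t : ℝ) - (s : ℝ)| ^ (2 * H))
  continuous_paths : ∀ᵐ ω ∂P, Continuous fun t ↦ B t ω

/-- `I` is the Riemann–Stieltjes integral `∫_0^t f dg`: the limit of the sums
`∑_k f(ξ_k) (g(p_{k+1}) - g(p_k))` over partitions `0 = p_0 ≤ p_1 ≤ ⋯ ≤ p_n = t` with arbitrary
intermediate points `ξ_k ∈ [p_k, p_{k+1}]`, as the mesh tends to zero. -/
def HasRSIntegral (f g : ℝ≥0 → ℝ) (t : ℝ≥0) (I : ℝ) : Prop :=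
  ∀ ε : ℝ, 0 < ε → ∃ δ : ℝ, 0 < δ ∧
    ∀ (n : ℕ) (p ξ : ℕ → ℝ≥0), p 0 = 0 → p n = t →
      (∀ k < n, p k ≤ ξ k ∧ ξ k ≤ p (k + 1) ∧ (p (k + 1) : ℝ) - (p k : ℝ) < δ) →
      |∑ k ∈ Finset.range n, f (ξ k) * (g (p (k + 1)) - g (p k)) - I| < ε

/-- The first zero `inf {t > 0 : f t = 0}` of a path, equal to `∞` if there is none. -/
noncomputable def hitZero (f : ℝ≥0 → ℝ) : ℝ≥0∞ :=
  ⨅ (t : ℝ≥0) (_ : 0 < t ∧ f t = 0), (t : ℝ≥0∞)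

/-- The path `x` satisfies, at time `t`, the integral form
`x_t = x₀ + a ∫_0^t x_s ds + σ ∫_0^t √x_s db_s` of `dx = a x dt + σ √x db`, where the
last integral exists as a Riemann–Stieltjes integral. -/
def SqrtEquationAt (a σ x₀ : ℝ) (b x : ℝ≥0 → ℝ) (t : ℝ≥0) : Prop :=
  ∃ I : ℝ, HasRSIntegral (fun s ↦ √(x s)) b t I ∧
    x t = x₀ + a * (∫ s in (0 : ℝ)..(t : ℝ), x s.toNNReal) + σ * I

/-- The process `X` has continuous paths, starts at `x₀` and satisfies
`dX = a X dt + σ √X dB` on `[0, τ₀)`, where `τ₀ = inf {t > 0 : X_t = 0}`.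
If `x₀ > 0`, such an `X` is automatically positive on `[0, τ₀)`. -/
structure IsSolutionUntilZero {Ω : Type*} [MeasurableSpace Ω] (P : Measure Ω)
    (a σ x₀ : ℝ) (B X : ℝ≥0 → Ω → ℝ) : Prop where
  aemeasurable : ∀ t, AEMeasurable (X t) P
  continuous_paths : ∀ᵐ ω ∂P, Continuous fun t ↦ X t ω
  initial : ∀ᵐ ω ∂P, X 0 ω = x₀
  equation : ∀ᵐ ω ∂P, ∀ t : ℝ≥0, (t : ℝ≥0∞) < hitZero (fun s ↦ X s ω) →
    SqrtEquationAt a σ x₀ (fun s ↦ B s ω) (fun s ↦ X s ω) t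

/-- The process `X` has continuous nonnegative paths, starts at `x₀` and satisfies
`dX = a X dt + σ √X dB` for all `t ≥ 0`. -/
structure IsSolution {Ω : Type*} [MeasurableSpace Ω] (P : Measure Ω)
    (a σ x₀ : ℝ) (B X : ℝ≥0 → Ω → ℝ) : Prop where
  aemeasurable : ∀ t, AEMeasurable (X t) P
  continuous_paths : ∀ᵐ ω ∂P, Continuous fun t ↦ X t ω
  nonneg : ∀ᵐ ω ∂P, ∀ t, 0 ≤ X t ω
  initial : ∀ᵐ ω ∂P, X 0 ω = x₀
  equation : ∀ᵐ ω ∂P, ∀ t : ℝ≥0,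
    SqrtEquationAt a σ x₀ (fun s ↦ B s ω) (fun s ↦ X s ω) t

/-- `Y` is a fractional Ornstein–Uhlenbeck process driven by `B`: it has continuous paths and
`Y_t = y₀ + a ∫_0^t Y_s ds + σ B_t` for all `t ≥ 0`. -/
structure IsFOU {Ω : Type*} [MeasurableSpace Ω] (P : Measure Ω)
    (a σ y₀ : ℝ) (B Y : ℝ≥0 → Ω → ℝ) : Prop where
  aemeasurable : ∀ t, AEMeasurable (Y t) P
  continuous_paths : ∀ᵐ ω ∂P, Continuous fun t ↦ Y t ω
  equation : ∀ᵐ ω ∂P, ∀ t : ℝ≥0,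
    Y t ω = y₀ + a * (∫ s in (0 : ℝ)..(t : ℝ), Y s.toNNReal ω) + σ * B t ω

end FCIR

namespace FCIR

open Filter Topology

/-! The argument is pathwise. For uniqueness, let `x` be any continuous solution, `u = √x`, and stay
before the first zero, so `u ≥ m > 0`. On each small interval the intermediate value theorem gives a
tag `ξ` at which `u` is the mean of its endpoint values, so the increment of `u ^ 2` is exactly `2 *
u ξ` times that of `u`. Dividing the equation by `2 * u ξ` turns it into the linear equation `du =
(a / 2) u dt + (σ / 2) db`, up to weighted errors of the Riemann–Stieltjes sums. The Saks–Henstock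
lemma (`sum_abs_sub_increment_le`) makes these errors small in total absolute value, so no
regularity of `x` beyond continuity is needed (`sqrt_eq_of_sqrtEquationAt`). The linear equation has
one solution, hence `u = Y` until the first zero.

For existence, solve the linear equation explicitly (`ouPath`), stop it at its first zero and square
it. Paths of `B` are Hölder of some exponent `α > 1/2`, so the candidate integral differs from each
term of a Riemann–Stieltjes sum by `O(h ^ (2 * α))`, which sums to zero
(`sqrtEquationAt_stopZero_sq`). Hölder continuity follows from Gaussian moments and dyadic chaining
(`IsFBM.ae_isLocHolder`). -/

/-! ### Riemann–Stieltjes sums and the Saks–Henstock lemma. -/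

/-- Lets each block of a partition be subdivided independently: the double array is read row by row
as one partition, with index `j = m * k + r`. -/
lemma HasRSIntegral.exists_blocks {f g : ℝ≥0 → ℝ} {T : ℝ≥0} {I : ℝ} (h : HasRSIntegral f g T I)
    {ε : ℝ} (hε : 0 < ε) :
    ∃ δ : ℝ, 0 < δ ∧ ∀ (n m : ℕ) (c : ℕ → ℝ≥0) (φ ζ : ℕ → ℕ → ℝ≥0), 0 < n → 0 < m → c 0 = 0 →
      c n = T → (∀ k < n, φ k 0 = c k) → (∀ k < n, φ k m = c (k + 1)) →
      (∀ k < n, ∀ r < m, φ k r ≤ ζ k r ∧ ζ k r ≤ φ k (r + 1) ∧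
        (φ k (r + 1) : ℝ) - (φ k r : ℝ) < δ) →
      |∑ k ∈ Finset.range n, ∑ r ∈ Finset.range m,
        f (ζ k r) * (g (φ k (r + 1)) - g (φ k r)) - I| < ε := by
  obtain ⟨δ, hδ, H⟩ := h ε hε
  refine ⟨δ, hδ, fun n m c φ ζ hn hm hc0 hcn h0 h1 hmesh ↦ ?_⟩
  set q : ℕ → ℝ≥0 := fun j ↦ if j / m < n then φ (j / m) (j % m) else T with hq
  set η : ℕ → ℝ≥0 := fun j ↦ ζ (j / m) (j % m) with hη
  have hdiv : ∀ k r, r < m → (m * k + r) / m = k := fun k r hr ↦ by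
    rw [Nat.mul_add_div hm, Nat.div_eq_of_lt hr, add_zero]
  have hmod : ∀ k r, r < m → (m * k + r) % m = r := fun k r hr ↦ by
    rw [Nat.mul_add_mod, Nat.mod_eq_of_lt hr]
  have hq0 : ∀ k < n, ∀ r < m, q (m * k + r) = φ k r := fun k hk r hr ↦ by
    simp only [hq, hdiv k r hr, hmod k r hr, hk, if_true]
  have hq1 : ∀ k < n, ∀ r < m, q (m * k + r + 1) = φ k (r + 1) := fun k hk r hr ↦ by
    rcases Nat.lt_or_ge (r + 1) m with hr' | hr'
    · exact hq0 k hk (r + 1) hr'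
    · have hrm : r + 1 = m := by omega
      have e : m * k + r + 1 = m * (k + 1) + 0 := by rw [mul_add, mul_one]; omega
      rw [hrm, h1 k hk, e]
      rcases Nat.lt_or_ge (k + 1) n with hk' | hk'
      · rw [hq0 (k + 1) hk' 0 hm, h0 (k + 1) hk']
      · have : k + 1 = n := by omega
        simp only [hq, hdiv (k + 1) 0 hm]
        rw [if_neg (by omega), this, hcn]
  have hη0 : ∀ k, ∀ r < m, η (m * k + r) = ζ k r := fun k r hr ↦ by
    simp only [hη, hdiv k r hr, hmod k r hr]
  have key := H (m * n) q η ?_ ?_ ?_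
  · have hsum : ∀ (F : ℕ → ℝ) (N : ℕ), ∑ j ∈ Finset.range (m * N), F j =
        ∑ k ∈ Finset.range N, ∑ r ∈ Finset.range m, F (m * k + r) := by
      intro F N
      induction N with
      | zero => simp
      | succ N ih => rw [mul_add, mul_one, Finset.sum_range_add, ih, Finset.sum_range_succ]
    rw [hsum] at key
    rw [Finset.sum_congr rfl fun k hk ↦ Finset.sum_congr rfl fun r hr ↦ ?_] at key
    · exact key
    · rw [Finset.mem_range] at hk hr
      simp only [hη0 k r hr, hq1 k hk r hr, hq0 k hk r hr]
  · have := hq0 0 hn 0 hm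
    simpa [h0 0 hn, hc0] using this
  · simp [hq, Nat.mul_div_cancel_left n hm]
  · intro j hj
    have hk : j / m < n := Nat.div_lt_of_lt_mul hj
    have hr : j % m < m := Nat.mod_lt _ hm
    have e : j = m * (j / m) + j % m := (Nat.div_add_mod j m).symm
    rw [e, hq1 _ hk _ hr, hq0 _ hk _ hr, hη0 _ _ hr]
    exact hmesh _ hk _ hr

lemma HasRSIntegral.eq_zero {f g : ℝ≥0 → ℝ} {I : ℝ} (H : HasRSIntegral f g 0 I) : I = 0 := by
  by_contra hI
  obtain ⟨δ, hδ, H'⟩ := H |I| (abs_pos.2 hI)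
  -- The empty partition has sum `0`, so the estimate reads `|I| < |I|`.
  have := H' 0 (fun _ ↦ 0) (fun _ ↦ 0) rfl rfl (by simp)
  simp at this

/-- The point `(k + r / m) h`. -/
noncomputable def gridPoint (h : ℝ≥0) (m k r : ℕ) : ℝ≥0 := (k + r / m) * h

lemma HasRSIntegral.tendsto_uniform {f g : ℝ≥0 → ℝ} {k : ℕ} {h : ℝ≥0} {I : ℝ}
    (H : HasRSIntegral f g (k * h) I) :
    Tendsto (fun m : ℕ ↦ ∑ i ∈ Finset.range k, ∑ r ∈ Finset.range m,
      f (gridPoint h m i r) * (g (gridPoint h m i (r + 1)) - g (gridPoint h m i r)))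
      atTop (𝓝 I) := by
  rcases Nat.eq_zero_or_pos k with rfl | hk
  · simp only [Finset.range_zero, Finset.sum_empty]
    have : I = 0 := HasRSIntegral.eq_zero (by simpa using H)
    rw [this]
    exact tendsto_const_nhds
  rw [Metric.tendsto_atTop]
  intro ε hε
  obtain ⟨δ, hδ, H'⟩ := H.exists_blocks hε
  obtain ⟨N, hN⟩ := exists_nat_gt ((h : ℝ) / δ)
  refine ⟨N + 1, fun m hm ↦ ?_⟩
  have hm0 : (0 : ℝ) < m := by exact_mod_cast (by omega : 0 < m)
  have hm1 : (m : ℝ≥0) ≠ 0 := by exact_mod_cast hm0.ne'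
  rw [Real.dist_eq]
  refine H' k m (fun k ↦ k * h) (gridPoint h m) (gridPoint h m) hk (by omega) (by simp) rfl
    (fun i _ ↦ by simp [gridPoint]) (fun i _ ↦ by simp [gridPoint, hm1]) fun i _ r _ ↦
    ⟨le_rfl, ?_, ?_⟩
  · simp only [gridPoint]; gcongr; simp
  · simp only [gridPoint]
    push_cast
    have : (h : ℝ) / m < δ := by
      rw [div_lt_iff₀ hm0]
      rw [div_lt_iff₀ hδ] at hN
      have : (N : ℝ) ≤ m := by exact_mod_cast (by omega : N ≤ m)
      nlinarith
    calc _ = (h : ℝ) / m := by ring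
      _ < δ := this

/-- Keep the single tagged term on blocks in `S` and refine the other blocks indefinitely. These
partitions stay within `ε` of `I T`, while in the limit the refined blocks contribute their exact
increments of `I` and cancel. -/
lemma abs_sum_subset_sub_increment_le {f g : ℝ≥0 → ℝ} {T : ℝ≥0} {I : ℝ≥0 → ℝ}
    (hI : ∀ t ≤ T, HasRSIntegral f g t (I t)) {ε : ℝ} (hε : 0 < ε) :
    ∃ δ : ℝ, 0 < δ ∧ ∀ (n : ℕ) (h : ℝ≥0) (ξ : ℕ → ℝ≥0), 0 < n → n * h = T → (h : ℝ) < δ →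
      (∀ k < n, k * h ≤ ξ k ∧ ξ k ≤ (k + 1 : ℕ) * h) → ∀ S ⊆ Finset.range n,
      |∑ k ∈ S, (f (ξ k) * (g ((k + 1 : ℕ) * h) - g (k * h)) -
        (I ((k + 1 : ℕ) * h) - I (k * h)))| ≤ ε := by
  obtain ⟨δ, hδ, H⟩ := (hI T le_rfl).exists_blocks hε
  refine ⟨δ, hδ, fun n h ξ hn hnh hh hξ S hS ↦ ?_⟩
  set A : ℕ → ℕ → ℝ := fun m k ↦ ∑ r ∈ Finset.range m,
      f (gridPoint h m k r) * (g (gridPoint h m k (r + 1)) - g (gridPoint h m k r)) with hA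
  have hle : ∀ k ≤ n, (k : ℝ≥0) * h ≤ T := fun k hk ↦ by rw [← hnh]; gcongr
  -- Uniform sums over `[0, (k + 1) h]` and `[0, k h]` differ exactly by the sum over block `k`.
  have hfine : ∀ k < n, Tendsto (fun m ↦ A m k) atTop (𝓝 (I ((k + 1 : ℕ) * h) - I (k * h))) := by
    intro k hk
    have h1 := (hI _ (hle (k + 1) hk)).tendsto_uniform
    have h2 := (hI _ (hle k hk.le)).tendsto_uniform
    refine (h1.sub h2).congr fun m ↦ ?_
    rw [Finset.sum_range_succ]
    simp [hA]
  set D : ℕ → ℝ := fun k ↦ f (ξ k) * (g ((k + 1 : ℕ) * h) - g (k * h)) with hD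
  have hlim : Tendsto (fun m ↦ ∑ k ∈ Finset.range n, if k ∈ S then D k else A m k) atTop
      (𝓝 (∑ k ∈ Finset.range n, if k ∈ S then D k else (I ((k + 1 : ℕ) * h) - I (k * h)))) := by
    refine tendsto_finsetSum _ fun k hk ↦ ?_
    split_ifs
    · exact tendsto_const_nhds
    · exact hfine k (Finset.mem_range.1 hk)
  have htot : ∑ k ∈ Finset.range n, (I ((k + 1 : ℕ) * h) - I (k * h)) = I T := by
    rw [Finset.sum_range_sub (fun k : ℕ ↦ I (k * h)), hnh]
    simp [(hI 0 zero_le).eq_zero]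
  have hlim' : (∑ k ∈ Finset.range n, if k ∈ S then D k else (I ((k + 1 : ℕ) * h) - I (k * h))) =
      ∑ k ∈ S, (D k - (I ((k + 1 : ℕ) * h) - I (k * h))) + I T := by
    rw [← htot, ← sub_eq_iff_eq_add, ← Finset.sum_sub_distrib, ← Finset.sum_subset hS]
    · exact Finset.sum_congr rfl fun k hk ↦ by simp [hk]
    · exact fun k _ hk ↦ by simp [hk]
  rw [hlim'] at hlim
  have hbd : ∀ᶠ m in atTop,
      |(∑ k ∈ Finset.range n, if k ∈ S then D k else A m k) - I T| ≤ ε := by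
    filter_upwards [eventually_gt_atTop 0] with m hm
    have hm1 : (m : ℝ≥0) ≠ 0 := by exact_mod_cast hm.ne'
    have hm0 : (0 : ℝ) < m := by exact_mod_cast hm
    -- A block in `S` is padded to `m` pieces: the first is the whole block, the others are
    -- degenerate at its right end.
    have := H n m (fun k ↦ k * h)
      (fun k r ↦ if k ∈ S then (if r = 0 then k * h else (k + 1 : ℕ) * h) else gridPoint h m k r)
      (fun k r ↦ if k ∈ S then (if r = 0 then ξ k else (k + 1 : ℕ) * h) else gridPoint h m k r)
      hn hm (by simp) hnh (fun k _ ↦ by simp [gridPoint]) (fun k _ ↦ by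
        simp [gridPoint, hm1, hm.ne']) ?_
    · refine le_of_eq_of_le ?_ this.le
      congr 2
      refine Finset.sum_congr rfl fun k hk ↦ ?_
      by_cases hkS : k ∈ S
      · obtain ⟨m', rfl⟩ : ∃ m', m = m' + 1 := ⟨m - 1, by omega⟩
        simp only [hkS, if_true]
        rw [Finset.sum_range_succ']
        simp [hD]
      · simp [hkS, hA]
    · intro k hk r hr
      by_cases hkS : k ∈ S
      · by_cases hr0 : r = 0
        · subst hr0
          simp only [hkS, if_true, zero_add, one_ne_zero, if_false]
          refine ⟨(hξ k hk).1, (hξ k hk).2, ?_⟩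
          push_cast
          linarith
        · simpa [hkS, hr0] using hδ
      · simp only [hkS, if_false]
        refine ⟨le_rfl, by simp only [gridPoint]; gcongr; simp, ?_⟩
        simp only [gridPoint]
        push_cast
        have : (h : ℝ) / m ≤ h := div_le_self h.2 (by exact_mod_cast hm)
        calc _ = (h : ℝ) / m := by ring
          _ < δ := by linarith
  simpa only [add_sub_cancel_right] using le_of_tendsto (hlim.sub_const (I T)).abs hbd
/-- **Saks–Henstock lemma** on uniform partitions. -/
lemma sum_abs_sub_increment_le {f g : ℝ≥0 → ℝ} {T : ℝ≥0} {I : ℝ≥0 → ℝ}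
    (hI : ∀ t ≤ T, HasRSIntegral f g t (I t)) {ε : ℝ} (hε : 0 < ε) :
    ∃ δ : ℝ, 0 < δ ∧ ∀ (n : ℕ) (h : ℝ≥0) (ξ : ℕ → ℝ≥0), 0 < n → n * h = T → (h : ℝ) < δ →
      (∀ k < n, k * h ≤ ξ k ∧ ξ k ≤ (k + 1 : ℕ) * h) →
      ∑ k ∈ Finset.range n, |f (ξ k) * (g ((k + 1 : ℕ) * h) - g (k * h)) -
        (I ((k + 1 : ℕ) * h) - I (k * h))| ≤ ε := by
  obtain ⟨δ, hδ, H⟩ := abs_sum_subset_sub_increment_le hI (half_pos hε)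
  refine ⟨δ, hδ, fun n h ξ hn hnh hh hξ ↦ ?_⟩
  set D : ℕ → ℝ := fun k ↦ f (ξ k) * (g ((k + 1 : ℕ) * h) - g (k * h)) -
        (I ((k + 1 : ℕ) * h) - I (k * h)) with hD
  -- Splitting by the sign of `D k` removes the absolute values, each half costing `ε / 2`.
  have h1 := H n h ξ hn hnh hh hξ _ (Finset.filter_subset (fun k ↦ 0 ≤ D k) _)
  have h2 := H n h ξ hn hnh hh hξ _ (Finset.filter_subset (fun k ↦ ¬ 0 ≤ D k) _)
  rw [← Finset.sum_filter_add_sum_filter_not _ (fun k ↦ 0 ≤ D k)]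
  rw [Finset.sum_congr rfl fun k hk ↦ abs_of_nonneg (Finset.mem_filter.1 hk).2,
    Finset.sum_congr rfl fun k hk ↦ abs_of_neg (not_le.1 (Finset.mem_filter.1 hk).2),
    Finset.sum_neg_distrib]
  linarith [(abs_le.1 h1).2, (abs_le.1 h2).1]

/-- Chain rule for the square root of a solution of `dx = a x dt + σ √x db`, for an arbitrary
continuous solution and an arbitrary integrator. -/
lemma sqrt_eq_of_sqrtEquationAt {a σ x₀ : ℝ} {b x : ℝ≥0 → ℝ} {T : ℝ≥0} (hx : Continuous x)
    (hpos : ∀ t ≤ T, 0 < x t) (heq : ∀ t ≤ T, SqrtEquationAt a σ x₀ b x t) :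
    √(x T) = √(x 0) + a / 2 * (∫ s in (0 : ℝ)..T, √(x s.toNNReal)) + σ / 2 * (b T - b 0) := by
  rcases eq_or_ne T 0 with rfl | hT
  · simp
  have hT0 : (0 : ℝ) < T := by positivity
  set u : ℝ≥0 → ℝ := fun t ↦ √(x t) with hu
  have hxu : ∀ t ≤ T, x t = u t ^ 2 := fun t ht ↦ (Real.sq_sqrt (hpos t ht).le).symm
  have huc : Continuous u := Real.continuous_sqrt.comp hx
  have hcpt : IsCompact (Set.Icc 0 T) := isCompact_Icc
  obtain ⟨t₀, ht₀, hmin⟩ := hcpt.exists_isMinOn ⟨0, by simp⟩ huc.continuousOn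
  obtain ⟨t₁, ht₁, hmax⟩ := hcpt.exists_isMaxOn ⟨0, by simp⟩ huc.continuousOn
  set m := u t₀ with hm
  set M := u t₁ with hM
  have hm0 : 0 < m := Real.sqrt_pos.2 (hpos t₀ ht₀.2)
  have hmu : ∀ t ≤ T, m ≤ u t := fun t ht ↦ hmin (⟨zero_le, ht⟩ : t ∈ Set.Icc 0 T)
  have huM : ∀ t ≤ T, u t ≤ M := fun t ht ↦ hmax (⟨zero_le, ht⟩ : t ∈ Set.Icc 0 T)
  have hM0 : 0 < M := hm0.trans_le (hmu t₁ ht₁.2)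
  set J : ℝ → ℝ := fun t ↦ ∫ s in (0 : ℝ)..t, x s.toNNReal with hJ
  set K : ℝ → ℝ := fun t ↦ ∫ s in (0 : ℝ)..t, u s.toNNReal with hK
  have hxi : Continuous fun s : ℝ ↦ x s.toNNReal := hx.comp continuous_real_toNNReal
  have hui : Continuous fun s : ℝ ↦ u s.toNNReal := huc.comp continuous_real_toNNReal
  choose! I hI hIeq using heq
  -- The first summand carries the Saks–Henstock error, the second the oscillation of `u` in the
  -- drift; both are divided by `2 * u ≥ 2 * m`.
  set C := |σ| / (2 * m) + |a| * T * M / (2 * m) with hC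
  have hC0 : 0 ≤ C := by positivity
  set E := u T - u 0 - a / 2 * K T - σ / 2 * (b T - b 0) with hE
  suffices h : ∀ ε > 0, |E| ≤ C * ε by
    have hE0 : |E| ≤ 0 := by
      refine le_of_forall_pos_le_add fun η hη ↦ ?_
      refine (h (η / (C + 1)) (by positivity)).trans ?_
      rw [zero_add, ← mul_div_assoc, div_le_iff₀ (by positivity)]
      nlinarith
    have := abs_nonpos_iff.1 hE0
    change u T = u 0 + a / 2 * K T + σ / 2 * (b T - b 0)
    linarith
  intro ε hε
  obtain ⟨δ, hδ, H⟩ := sum_abs_sub_increment_le hI hε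
  obtain ⟨η, hη, hmod⟩ := Metric.uniformContinuousOn_iff_le.1
    (hcpt.uniformContinuousOn_of_continuous huc.continuousOn) ε hε
  obtain ⟨N, hN⟩ := exists_nat_gt ((T : ℝ) / min δ η)
  set n := N + 1 with hn
  have hn0 : (0 : ℝ) < n := by positivity
  set h : ℝ≥0 := T / n with hh
  have hnh : n * h = T := by rw [hh]; exact mul_div_cancel₀ T (by positivity)
  have hhsmall : (h : ℝ) < min δ η := by
    rw [hh, NNReal.coe_div, NNReal.coe_natCast, div_lt_iff₀ hn0]
    rw [div_lt_iff₀ (lt_min hδ hη)] at hN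
    have : (N : ℝ) ≤ n := by simp [hn]
    nlinarith [lt_min hδ hη]
  set c : ℕ → ℝ≥0 := fun k ↦ k * h with hc
  have hcle : ∀ k ≤ n, c k ≤ T := fun k hk ↦ by rw [← hnh]; simp only [hc]; gcongr
  have hcstep : ∀ k, c k ≤ c (k + 1) := fun k ↦ by simp only [hc]; gcongr; simp
  have hcdiff : ∀ k, (c (k + 1) : ℝ) - c k = h := fun k ↦ by simp only [hc]; push_cast; ring
  -- With this tag, `u (c (k + 1)) ^ 2 - u (c k) ^ 2` factors exactly as `2 * u ξ` times the
  -- increment of `u`, with no quadratic remainder.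
  have hivt : ∀ k, ∃ ξ, (c k ≤ ξ ∧ ξ ≤ c (k + 1)) ∧ u ξ = (u (c k) + u (c (k + 1))) / 2 := by
    intro k
    rcases le_total (u (c k)) (u (c (k + 1))) with hle | hle
    · obtain ⟨ξ, h1, h2⟩ := intermediate_value_Icc (hcstep k) huc.continuousOn
        (⟨by linarith, by linarith⟩ :
          (u (c k) + u (c (k + 1))) / 2 ∈ Set.Icc (u (c k)) (u (c (k + 1))))
      exact ⟨ξ, h1, h2⟩
    · obtain ⟨ξ, h1, h2⟩ := intermediate_value_Icc' (hcstep k) huc.continuousOn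
        (⟨by linarith, by linarith⟩ :
          (u (c k) + u (c (k + 1))) / 2 ∈ Set.Icc (u (c (k + 1))) (u (c k)))
      exact ⟨ξ, h1, h2⟩
  choose ξ hξ hξu using hivt
  have hSH := H n h ξ (by omega) hnh (hhsmall.trans_le (min_le_left _ _)) fun k _ ↦ hξ k
  set D : ℕ → ℝ := fun k ↦ u (ξ k) * (b (c (k + 1)) - b (c k)) - (I (c (k + 1)) - I (c k)) with hD
  have hSH' : ∑ k ∈ Finset.range n, |D k| ≤ ε := hSH
  set W : ℝ≥0 → ℝ := fun t ↦ u t - a / 2 * K t - σ / 2 * b t with hW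
  have hWE : ∑ k ∈ Finset.range n, (W (c (k + 1)) - W (c k)) = E := by
    rw [Finset.sum_range_sub (fun k ↦ W (c k))]
    have h1 : c n = T := hnh
    have h2 : c 0 = 0 := by simp [hc]
    rw [h1, h2]
    simp only [hW, hE, hK]
    simp
    ring
  have hstep : ∀ k < n, |W (c (k + 1)) - W (c k)| ≤ |σ| / (2 * m) * |D k| +
      |a| / (2 * m) * (M * ε * h) := by
    intro k hk
    have hk1 := hcle (k + 1) hk
    have hk0 := hcle k hk.le
    have hξT : ξ k ≤ T := (hξ k).2.trans hk1
    have hp := hmu (ξ k) hξT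
    have hp0 : 0 < u (ξ k) := hm0.trans_le hp
    have hinc : u (c (k + 1)) ^ 2 - u (c k) ^ 2 =
        a * (J (c (k + 1)) - J (c k)) + σ * (I (c (k + 1)) - I (c k)) := by
      rw [← hxu _ hk1, ← hxu _ hk0]
      have h1 := hIeq _ hk1
      have h2 := hIeq _ hk0
      simp only [hJ]
      linarith
    have hle' : (c k : ℝ) ≤ c (k + 1) := by exact_mod_cast hcstep k
    have hJ' : J (c (k + 1)) - J (c k) = ∫ s in (c k : ℝ)..c (k + 1), x s.toNNReal :=
      intervalIntegral.integral_interval_sub_left (hxi.intervalIntegrable _ _)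
        (hxi.intervalIntegrable _ _)
    have hK' : K (c (k + 1)) - K (c k) = ∫ s in (c k : ℝ)..c (k + 1), u s.toNNReal :=
      intervalIntegral.integral_interval_sub_left (hui.intervalIntegrable _ _)
        (hui.intervalIntegrable _ _)
    have hdiff : |J (c (k + 1)) - J (c k) - u (ξ k) * (K (c (k + 1)) - K (c k))| ≤ M * ε * h := by
      rw [hJ', hK', ← intervalIntegral.integral_const_mul,
        ← intervalIntegral.integral_sub (hxi.intervalIntegrable _ _)
          ((hui.intervalIntegrable _ _).const_mul (u (ξ k)))]
      have := intervalIntegral.norm_integral_le_of_norm_le_const (a := (c k : ℝ)) (b := c (k + 1))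
        (C := M * ε) (f := fun s : ℝ ↦ x s.toNNReal - u (ξ k) * u s.toNNReal) fun s hs ↦ ?_
      · rw [Real.norm_eq_abs, hcdiff, NNReal.abs_eq] at this
        exact this
      · rw [Set.uIoc_of_le hle'] at hs
        have hs1 : s.toNNReal ≤ c (k + 1) := Real.toNNReal_le_iff_le_coe.2 hs.2
        have hs0 : c k ≤ s.toNNReal := NNReal.le_toNNReal_of_coe_le hs.1.le
        have hsT := hs1.trans hk1
        rw [hxu _ hsT, Real.norm_eq_abs,
          show u s.toNNReal ^ 2 - u (ξ k) * u s.toNNReal =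
            u s.toNNReal * (u s.toNNReal - u (ξ k)) by ring, abs_mul,
          abs_of_pos (hm0.trans_le (hmu _ hsT))]
        refine mul_le_mul (huM _ hsT) ?_ (abs_nonneg _) hM0.le
        refine hmod _ ⟨zero_le, hsT⟩ _ ⟨zero_le, hξT⟩ ?_
        rw [NNReal.dist_eq]
        have e1 : (s.toNNReal : ℝ) ≤ c (k + 1) := hs1
        have e2 : (c k : ℝ) ≤ s.toNNReal := hs0
        have e3 : (ξ k : ℝ) ≤ c (k + 1) := (hξ k).2
        have e4 : (c k : ℝ) ≤ ξ k := (hξ k).1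
        have e5 := hcdiff k
        have e6 := hhsmall.trans_le (min_le_right _ _)
        rw [abs_le]
        constructor <;> linarith
    have hid : W (c (k + 1)) - W (c k) = -(σ / (2 * u (ξ k))) * D k + a / (2 * u (ξ k)) *
        (J (c (k + 1)) - J (c k) - u (ξ k) * (K (c (k + 1)) - K (c k))) := by
      have h1 : u (c (k + 1)) - u (c k) =
          (a * (J (c (k + 1)) - J (c k)) + σ * (I (c (k + 1)) - I (c k))) / (2 * u (ξ k)) := by
        rw [← hinc, eq_div_iff (by positivity), hξu]
        ring
      have h2 : W (c (k + 1)) - W (c k) = (u (c (k + 1)) - u (c k)) -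
          a / 2 * (K (c (k + 1)) - K (c k)) - σ / 2 * (b (c (k + 1)) - b (c k)) := by
        simp only [hW]; ring
      rw [h2, h1]
      simp only [hD]
      field_simp
      ring
    rw [hid]
    refine (abs_add_le _ _).trans ?_
    rw [abs_mul, abs_mul, abs_neg, abs_div, abs_div, abs_of_pos (by positivity : 0 < 2 * u (ξ k))]
    gcongr
  rw [← hWE]
  refine (Finset.abs_sum_le_sum_abs _ _).trans
    ((Finset.sum_le_sum fun k hk ↦ hstep k (Finset.mem_range.1 hk)).trans ?_)
  rw [Finset.sum_add_distrib, ← Finset.mul_sum, Finset.sum_const, Finset.card_range, nsmul_eq_mul]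
  have hnh' : (n : ℝ) * h = T := by exact_mod_cast congrArg NNReal.toReal hnh
  calc _ ≤ |σ| / (2 * m) * ε + n * (|a| / (2 * m) * (M * ε * h)) := by gcongr
    _ = C * ε := by rw [hC, ← hnh']; ring

/-! ### The linear equation: uniqueness and explicit solution. -/

/-- Integrating factor: for the primitive `F` of `D`, the function `exp (-c * t) * F t` has zero
derivative on `[0, T)`. -/
lemma eq_zero_of_eq_mul_integral {c T : ℝ} {D : ℝ → ℝ} (hD : Continuous D)
    (h : ∀ t ∈ Set.Icc 0 T, D t = c * ∫ s in (0 : ℝ)..t, D s) : ∀ t ∈ Set.Icc 0 T, D t = 0 := by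
  set F : ℝ → ℝ := fun t ↦ ∫ s in (0 : ℝ)..t, D s with hF
  have hF' : ∀ t, HasDerivAt F (D t) t := fun t ↦
    (hD.integral_hasStrictDerivAt 0 t).hasDerivAt
  have hG' : ∀ t, HasDerivAt (fun t ↦ Real.exp (-c * t) * F t)
      (Real.exp (-c * t) * (-c) * F t + Real.exp (-c * t) * D t) t := fun t ↦ by
    have := (((hasDerivAt_id' t).const_mul (-c)).exp).mul (hF' t)
    rwa [mul_one] at this
  intro t ht
  have hconst := constant_of_has_deriv_right_zero (a := 0) (b := T)
    (f := fun t ↦ Real.exp (-c * t) * F t)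
    (fun t _ ↦ (hG' t).continuousAt.continuousWithinAt) (fun t ht ↦ by
      have := (hG' t).hasDerivWithinAt (s := Set.Ici t)
      rw [h t ⟨ht.1, ht.2.le⟩] at this
      convert this using 1
      ring) t ht
  have hF0 : F 0 = 0 := by simp [hF]
  have : F t = 0 := by simpa [hF0] using hconst
  rw [h t ht]
  change c * F t = 0
  rw [this, mul_zero]

/-- The solution of `dy = c y dt + s db`, `y_0 = y₀`, for an integrator with `b_0 = 0`. -/
noncomputable def ouPath (c s y₀ : ℝ) (b : ℝ≥0 → ℝ) (t : ℝ≥0) : ℝ :=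
  Real.exp (c * t) * (y₀ + c * s * ∫ u in (0 : ℝ)..t, Real.exp (-c * u) * b u.toNNReal) + s * b t

lemma continuous_ouPath (c s y₀ : ℝ) {b : ℝ≥0 → ℝ} (hb : Continuous b) :
    Continuous (ouPath c s y₀ b) := by
  have hi : Continuous fun u : ℝ ↦ Real.exp (-c * u) * b u.toNNReal := by fun_prop
  have : Continuous fun t : ℝ ↦ ∫ u in (0 : ℝ)..t, Real.exp (-c * u) * b u.toNNReal :=
    intervalIntegral.continuous_primitive (fun _ _ ↦ hi.intervalIntegrable _ _) 0
  unfold ouPath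
  have := this.comp NNReal.continuous_coe
  fun_prop

lemma ouPath_eq (c s y₀ : ℝ) {b : ℝ≥0 → ℝ} (hb : Continuous b) (t : ℝ≥0) :
    ouPath c s y₀ b t =
      y₀ + c * (∫ u in (0 : ℝ)..t, ouPath c s y₀ b u.toNNReal) + s * b t := by
  have hi : Continuous fun u : ℝ ↦ Real.exp (-c * u) * b u.toNNReal := by fun_prop
  set F : ℝ → ℝ := fun t ↦ ∫ u in (0 : ℝ)..t, Real.exp (-c * u) * b u.toNNReal with hF
  have hF' : ∀ t, HasDerivAt F (Real.exp (-c * t) * b t.toNNReal) t := fun t ↦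
    (hi.integral_hasStrictDerivAt 0 t).hasDerivAt
  -- `V` is `ouPath` without the term `s * b`; it is differentiable with `V' = c * (V + s * b)`, so
  -- `b` itself is never differentiated.
  set V : ℝ → ℝ := fun t ↦ Real.exp (c * t) * (y₀ + c * s * F t) with hV
  have hV' : ∀ t, HasDerivAt V (c * (V t + s * b t.toNNReal)) t := fun t ↦ by
    have := (((hasDerivAt_id' t).const_mul c).exp).mul (((hF' t).const_mul (c * s)).const_add y₀)
    refine this.congr_deriv ?_
    have he : Real.exp (c * t) * Real.exp (-c * t) = 1 := by
      rw [← Real.exp_add]; simp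
    simp only [hV]
    linear_combination (c * s * b t.toNNReal) * he
  have hVc : Continuous V := continuous_iff_continuousAt.2 fun t ↦ (hV' t).continuousAt
  have hFTC := intervalIntegral.integral_eq_sub_of_hasDerivAt (a := 0) (b := (t : ℝ))
    (fun u _ ↦ hV' u) (Continuous.intervalIntegrable (by fun_prop) _ _)
  rw [intervalIntegral.integral_const_mul] at hFTC
  have hcongr : ∫ u in (0 : ℝ)..t, ouPath c s y₀ b u.toNNReal =
      ∫ u in (0 : ℝ)..t, (V u + s * b u.toNNReal) := by
    refine intervalIntegral.integral_congr fun u hu ↦ ?_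
    rw [Set.uIcc_of_le t.coe_nonneg] at hu
    simp only [ouPath, hV, hF, Real.coe_toNNReal u hu.1]
  have hV0 : V 0 = y₀ := by simp [hV, hF]
  rw [hcongr, hFTC, hV0]
  change V t + s * b t = _
  ring

/-! ### First zeros, and identification of solutions before them. -/

lemma pos_of_lt_hitZero {x : ℝ≥0 → ℝ} (hx : Continuous x) (h0 : 0 < x 0) {t : ℝ≥0}
    (ht : (t : ℝ≥0∞) < hitZero x) : 0 < x t := by
  by_contra! hneg
  obtain ⟨r, hr, hr0⟩ := intermediate_value_Icc' (zero_le : 0 ≤ t) hx.continuousOn ⟨hneg, h0.le⟩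
  have hrpos : 0 < r := pos_iff_ne_zero.2 fun h ↦ by rw [h] at hr0; exact h0.ne' hr0
  have h1 : hitZero x ≤ r := iInf₂_le r ⟨hrpos, hr0⟩
  exact absurd (ht.trans_le h1) (not_lt.2 (by exact_mod_cast hr.2))

/-- The zero set is closed, so its infimum is attained; `x 0 ≠ 0` makes the restriction to positive
times harmless. -/
lemma exists_hitZero_eq {x : ℝ≥0 → ℝ} (hx : Continuous x) (h0 : x 0 ≠ 0)
    (hfin : hitZero x ≠ ⊤) : ∃ r : ℝ≥0, 0 < r ∧ x r = 0 ∧ hitZero x = r := by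
  have hne : {t | x t = 0}.Nonempty := by
    by_contra hempty
    rw [Set.not_nonempty_iff_eq_empty] at hempty
    refine hfin (iInf₂_eq_top.2 fun t ht ↦ ?_)
    have : t ∈ {t | x t = 0} := ht.2
    simp [hempty] at this
  have hmem : x (sInf {t | x t = 0}) = 0 :=
    (isClosed_eq hx continuous_const).csInf_mem hne (OrderBot.bddBelow _)
  have hpos : 0 < sInf {t | x t = 0} := pos_iff_ne_zero.2 fun h ↦ h0 (h ▸ hmem)
  refine ⟨_, hpos, hmem, le_antisymm (iInf₂_le _ ⟨hpos, hmem⟩) (le_iInf₂ fun t ht ↦ ?_)⟩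
  exact ENNReal.coe_le_coe.2 (csInf_le (OrderBot.bddBelow _) ht.2)

/-- Until its first zero, a solution of `dx = a x dt + σ √x db` is the square of the solution of
`dy = (a / 2) y dt + (σ / 2) db`. -/
lemma eq_sq_of_sqrtEquationAt {a σ x₀ : ℝ} (hx₀ : 0 < x₀) {b x y : ℝ≥0 → ℝ} (hb0 : b 0 = 0)
    (hx : Continuous x) (hx0 : x 0 = x₀) (hy : Continuous y)
    (hxeq : ∀ t : ℝ≥0, (t : ℝ≥0∞) < hitZero x → SqrtEquationAt a σ x₀ b x t)
    (hyeq : ∀ t : ℝ≥0, y t = √x₀ + a / 2 * (∫ s in (0 : ℝ)..t, y s.toNNReal) + σ / 2 * b t) :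
    hitZero x = hitZero y ∧ ∀ t : ℝ≥0, (t : ℝ≥0∞) < hitZero x → x t = y t ^ 2 := by
  have hxpos : ∀ t : ℝ≥0, (t : ℝ≥0∞) < hitZero x → 0 < x t := fun t ht ↦
    pos_of_lt_hitZero hx (hx0 ▸ hx₀) ht
  have hsqrt : ∀ t : ℝ≥0, (t : ℝ≥0∞) < hitZero x → √(x t) = y t := by
    intro T hT
    have hlt : ∀ t ≤ T, (t : ℝ≥0∞) < hitZero x := fun t ht ↦
      lt_of_le_of_lt (by exact_mod_cast ht) hT
    have hxs : Continuous fun s : ℝ ↦ √(x s.toNNReal) := by fun_prop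
    have hys : Continuous fun s : ℝ ↦ y s.toNNReal := by fun_prop
    -- The terms in `b` cancel in the difference, which solves the homogeneous equation.
    have key := eq_zero_of_eq_mul_integral (c := a / 2) (T := T)
      (D := fun s : ℝ ↦ √(x s.toNNReal) - y s.toNNReal) (hxs.sub hys) (fun t ht ↦ by
        rw [intervalIntegral.integral_sub (hxs.intervalIntegrable _ _)
          (hys.intervalIntegrable _ _)]
        have htT : t.toNNReal ≤ T := Real.toNNReal_le_iff_le_coe.2 ht.2
        have h1 := sqrt_eq_of_sqrtEquationAt hx
          (fun r hr ↦ hxpos r (hlt r (hr.trans htT))) (fun r hr ↦ hxeq r (hlt r (hr.trans htT)))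
        have h2 := hyeq t.toNNReal
        rw [Real.coe_toNNReal t ht.1] at h1 h2
        rw [hx0, hb0] at h1
        linarith) T ⟨T.coe_nonneg, le_rfl⟩
    simpa [sub_eq_zero] using key
  have hsq : ∀ t : ℝ≥0, (t : ℝ≥0∞) < hitZero x → x t = y t ^ 2 := fun t ht ↦ by
    rw [← hsqrt t ht, Real.sq_sqrt (hxpos t ht).le]
  refine ⟨le_antisymm (le_iInf₂ fun t ht ↦ ?_) ?_, hsq⟩
  · by_contra! hlt
    have := hsq t hlt
    rw [ht.2] at this
    exact (hxpos t hlt).ne' (by simpa using this)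
  · rcases eq_or_ne (hitZero x) ⊤ with htop | hfin
    · simp [htop]
    obtain ⟨r, hr, hxr, hreq⟩ := exists_hitZero_eq hx (hx0 ▸ hx₀.ne') hfin
    rw [hreq]
    refine iInf₂_le r ⟨hr, ?_⟩
    -- The identity is known only strictly before `r`; continuity carries it to `r` and forces `y r
    -- = 0`.
    have hcl : r ∈ closure (Set.Iio r) := by
      rw [closure_Iio' (⟨0, hr⟩ : (Set.Iio r).Nonempty)]; exact Set.mem_Iic.2 le_rfl
    have hr' : x r = y r ^ 2 := by
      refine closure_minimal (s := Set.Iio r) (t := {t | x t = y t ^ 2}) (fun t ht ↦ hsq t ?_)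
        (isClosed_eq hx (hy.pow 2)) hcl
      rw [hreq]; exact_mod_cast ht
    rw [hxr] at hr'
    exact pow_eq_zero_iff two_ne_zero |>.1 hr'.symm

/-! ### Hölder paths and existence of a solution. -/

/-- Hölder continuity of exponent `α` on bounded intervals, at distances at most one. -/
def IsLocHolder (α : ℝ) (f : ℝ≥0 → ℝ) : Prop :=
  ∀ T : ℝ≥0, ∃ K : ℝ, 0 ≤ K ∧ ∀ s t : ℝ≥0, s ≤ t → t ≤ T → (t : ℝ) - s ≤ 1 →
    |f t - f s| ≤ K * ((t : ℝ) - s) ^ α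

/-- The path `y` up to its first zero, and zero afterwards. -/
noncomputable def stopZero (y : ℝ≥0 → ℝ) (t : ℝ≥0) : ℝ :=
  open Classical in if (t : ℝ≥0∞) < hitZero y then y t else 0

lemma stopZero_zero {y : ℝ≥0 → ℝ} (hy : Continuous y) (h0 : 0 < y 0) : stopZero y 0 = y 0 := by
  refine if_pos ?_
  by_cases hfin : hitZero y = ⊤
  · simp [hfin]
  · obtain ⟨r, hr, -, hreq⟩ := exists_hitZero_eq hy h0.ne' hfin
    rw [hreq]; exact_mod_cast hr

lemma stopZero_nonneg {y : ℝ≥0 → ℝ} (hy : Continuous y) (h0 : 0 < y 0) (t : ℝ≥0) :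
    0 ≤ stopZero y t := by
  unfold stopZero
  split_ifs with h
  · exact (pos_of_lt_hitZero hy h0 h).le
  · exact le_rfl

/-- Applied to the right end of a partition interval: either stopping has had no effect there, or
the stopped path vanishes at that end. -/
lemma stopZero_eq_or {y : ℝ≥0 → ℝ} (t : ℝ≥0) :
    (∀ s ≤ t, stopZero y s = y s) ∨ stopZero y t = 0 := by
  by_cases h : (t : ℝ≥0∞) < hitZero y
  · exact Or.inl fun s hs ↦ if_pos (lt_of_le_of_lt (by exact_mod_cast hs) h)
  · exact Or.inr (if_neg h)

lemma stopZero_eq_self_or_min {y : ℝ≥0 → ℝ} (hy : Continuous y) (h0 : 0 < y 0) :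
    stopZero y = y ∨ ∃ r : ℝ≥0, stopZero y = fun t ↦ y (min t r) := by
  by_cases hfin : hitZero y = ⊤
  · exact Or.inl (funext fun t ↦ if_pos (by simp [hfin]))
  · obtain ⟨r, hr, hyr, hreq⟩ := exists_hitZero_eq hy h0.ne' hfin
    refine Or.inr ⟨r, funext fun t ↦ ?_⟩
    unfold stopZero
    simp only [hreq, ENNReal.coe_lt_coe]
    split_ifs with h
    · rw [min_eq_left h.le]
    · rw [min_eq_right (not_lt.1 h), hyr]

lemma continuous_stopZero {y : ℝ≥0 → ℝ} (hy : Continuous y) (h0 : 0 < y 0) :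
    Continuous (stopZero y) := by
  rcases stopZero_eq_self_or_min hy h0 with h | ⟨r, h⟩
  · rwa [h]
  · rw [h]; fun_prop

/-- Stopping is composition with the monotone 1-Lipschitz map `t ↦ min t r`. -/
lemma IsLocHolder.stopZero {α : ℝ} (hα : 0 < α) {y : ℝ≥0 → ℝ} (hy : Continuous y) (h0 : 0 < y 0)
    (H : IsLocHolder α y) : IsLocHolder α (stopZero y) := by
  rcases stopZero_eq_self_or_min hy h0 with h | ⟨r, h⟩
  · rwa [h]
  intro T
  obtain ⟨K, hK, HK⟩ := H T
  refine ⟨K, hK, fun s t hst htT h1 ↦ ?_⟩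
  simp only [h]
  have hst' : (s : ℝ) ≤ t := hst
  have hle : ((min t r : ℝ≥0) : ℝ) - (min s r : ℝ≥0) ≤ t - s := by
    rw [NNReal.coe_min, NNReal.coe_min]
    rcases le_total (s : ℝ) r with h2 | h2 <;> rcases le_total (t : ℝ) r with h3 | h3 <;>
      simp only [h2, h3, min_eq_left, min_eq_right] <;> linarith
  have hmono : min s r ≤ min t r := min_le_min_right r hst
  refine (HK _ _ hmono ((min_le_left _ _).trans htT) (hle.trans h1)).trans ?_
  have : (0 : ℝ) ≤ ((min t r : ℝ≥0) : ℝ) - (min s r : ℝ≥0) := sub_nonneg.2 (by exact_mod_cast hmono)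
  gcongr

/-- On a partition of `[0, T]`, additive quantities are approximated by sums with local errors of
order `1 + η`. -/
lemma hasRSIntegral_of_local {f g A : ℝ≥0 → ℝ} {T : ℝ≥0} {β C : ℝ} (hβ : 1 < β) (hC : 0 ≤ C)
    (hA0 : A 0 = 0)
    (H : ∀ p ξ q : ℝ≥0, p ≤ ξ → ξ ≤ q → q ≤ T → (q : ℝ) - p ≤ 1 →
      |f ξ * (g q - g p) - (A q - A p)| ≤ C * ((q : ℝ) - p) ^ β) :
    HasRSIntegral f g T (A T) := by
  intro ε hε
  have hη : 0 < ε / (C * T + 1) := by positivity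
  -- This makes `h ^ (β - 1) ≤ ε / (C * T + 1)` for steps `h` below the mesh bound; the `+ 1` gives
  -- strictness and covers `C * T = 0`.
  refine ⟨min 1 ((ε / (C * T + 1)) ^ (1 / (β - 1))), by positivity, fun n p ξ hp0 hpn hp ↦ ?_⟩
  have hmono : ∀ k < n, p k ≤ p (k + 1) := fun k hk ↦ (hp k hk).1.trans (hp k hk).2.1
  have hle : ∀ k ≤ n, p k ≤ T := by
    have : ∀ j, ∀ k ≤ n, k + j = n → p k ≤ T := by
      intro j
      induction j with
      | zero => intro k _ h; rw [← hpn, ← h]; rfl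
      | succ j ih =>
        intro k _ h
        exact (hmono k (by omega)).trans (ih (k + 1) (by omega) (by omega))
    exact fun k hk ↦ this (n - k) k hk (by omega)
  have htel : A T = ∑ k ∈ Finset.range n, (A (p (k + 1)) - A (p k)) := by
    rw [Finset.sum_range_sub (fun k ↦ A (p k)), hpn, hp0, hA0, sub_zero]
  have htel' : (T : ℝ) = ∑ k ∈ Finset.range n, ((p (k + 1) : ℝ) - p k) := by
    rw [Finset.sum_range_sub (fun k ↦ (p k : ℝ)), hpn, hp0, NNReal.coe_zero, sub_zero]
  rw [htel, ← Finset.sum_sub_distrib]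
  refine (Finset.abs_sum_le_sum_abs _ _).trans_lt ?_
  have hstep : ∀ k ∈ Finset.range n,
      |f (ξ k) * (g (p (k + 1)) - g (p k)) - (A (p (k + 1)) - A (p k))| ≤
        C * (ε / (C * T + 1)) * ((p (k + 1) : ℝ) - p k) := by
    intro k hk
    rw [Finset.mem_range] at hk
    obtain ⟨h1, h2, h3⟩ := hp k hk
    refine (H _ _ _ h1 h2 (hle _ hk) (h3.le.trans (min_le_left _ _))).trans ?_
    rw [mul_assoc]
    refine mul_le_mul_of_nonneg_left ?_ hC
    have h0 : (0 : ℝ) ≤ (p (k + 1) : ℝ) - p k := sub_nonneg.2 (by exact_mod_cast hmono k hk)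
    have hsplit : ((p (k + 1) : ℝ) - p k) ^ β =
        ((p (k + 1) : ℝ) - p k) ^ (β - 1) * ((p (k + 1) : ℝ) - p k) := by
      rw [← Real.rpow_add_one' h0 (by linarith)]; congr 1; ring
    rw [hsplit]
    refine mul_le_mul_of_nonneg_right ?_ h0
    have hb : 0 < β - 1 := by linarith
    calc ((p (k + 1) : ℝ) - p k) ^ (β - 1)
        ≤ ((ε / (C * T + 1)) ^ (1 / (β - 1))) ^ (β - 1) := by
          gcongr
          exact h3.le.trans (min_le_right _ _)
      _ = ε / (C * T + 1) := by
          rw [← Real.rpow_mul hη.le, one_div_mul_cancel hb.ne', Real.rpow_one]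
  refine (Finset.sum_le_sum hstep).trans_lt ?_
  rw [← Finset.mul_sum, ← htel']
  have hCT : 0 ≤ C * T := by positivity
  calc C * (ε / (C * T + 1)) * T = ε * (C * T / (C * T + 1)) := by ring
    _ < ε * 1 := by
        gcongr
        rw [div_lt_one (by positivity)]
        linarith
    _ = ε := mul_one ε

lemma exists_abs_le {f : ℝ≥0 → ℝ} (hf : Continuous f) (T : ℝ≥0) :
    ∃ M : ℝ, 0 ≤ M ∧ ∀ t ≤ T, |f t| ≤ M := by
  obtain ⟨M, hM⟩ := (isCompact_Icc (a := (0 : ℝ≥0)) (b := T)).exists_bound_of_continuousOn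
    hf.continuousOn
  exact ⟨M, (norm_nonneg _).trans (hM 0 ⟨le_rfl, zero_le⟩), fun t ht ↦ hM t ⟨zero_le, ht⟩⟩

lemma abs_integral_toNNReal_le {f : ℝ≥0 → ℝ} {p q : ℝ≥0} (hpq : p ≤ q) {M : ℝ}
    (hM : ∀ s, p ≤ s → s ≤ q → |f s| ≤ M) :
    |∫ s in (p : ℝ)..q, f s.toNNReal| ≤ M * ((q : ℝ) - p) := by
  have hpq' : (p : ℝ) ≤ q := hpq
  have := intervalIntegral.norm_integral_le_of_norm_le_const (a := (p : ℝ)) (b := q) (C := M)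
    (f := fun s : ℝ ↦ f s.toNNReal) fun s hs ↦ by
      rw [Set.uIoc_of_le hpq'] at hs
      exact hM _ (NNReal.le_toNNReal_of_coe_le hs.1.le) (Real.toNNReal_le_iff_le_coe.2 hs.2)
  rwa [Real.norm_eq_abs, abs_of_nonneg (sub_nonneg.2 hpq')] at this

lemma integral_toNNReal_sub {f : ℝ≥0 → ℝ} (hf : Continuous f) (p q : ℝ≥0) :
    (∫ s in (0 : ℝ)..q, f s.toNNReal) - (∫ s in (0 : ℝ)..p, f s.toNNReal) =
      ∫ s in (p : ℝ)..q, f s.toNNReal :=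
  have hfi : Continuous fun s : ℝ ↦ f s.toNNReal := hf.comp continuous_real_toNNReal
  intervalIntegral.integral_interval_sub_left (hfi.intervalIntegrable _ _)
    (hfi.intervalIntegrable _ _)

lemma le_rpow_of_le_one' {h α : ℝ} (h0 : 0 ≤ h) (h1 : h ≤ 1) (hα0 : 0 < α) (hα : α ≤ 1) :
    h ≤ h ^ α := by
  rcases h0.eq_or_lt with rfl | hpos
  · simp [Real.zero_rpow hα0.ne']
  · calc h = h ^ (1 : ℝ) := (Real.rpow_one h).symm
      _ ≤ h ^ α := Real.rpow_le_rpow_of_exponent_ge hpos h1 hα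

/-- The drift is Lipschitz on bounded intervals, and `h ≤ h ^ α` because distances are at most one.
-/
lemma IsLocHolder.of_ouEquation {α c s y₀ : ℝ} (hα0 : 0 < α) (hα : α ≤ 1) {b y : ℝ≥0 → ℝ}
    (hb : IsLocHolder α b) (hy : Continuous y)
    (hyeq : ∀ t : ℝ≥0, y t = y₀ + c * (∫ u in (0 : ℝ)..t, y u.toNNReal) + s * b t) :
    IsLocHolder α y := by
  intro T
  obtain ⟨K, hK, HK⟩ := hb T
  obtain ⟨M, hM, HM⟩ := exists_abs_le hy T
  refine ⟨|c| * M + |s| * K, by positivity, fun p q hpq hq h1 ↦ ?_⟩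
  have hpq' : (0 : ℝ) ≤ (q : ℝ) - p := sub_nonneg.2 hpq
  have e : y q - y p = c * (∫ u in (p : ℝ)..q, y u.toNNReal) + s * (b q - b p) := by
    rw [← integral_toNNReal_sub hy, hyeq q, hyeq p]; ring
  have hi := abs_integral_toNNReal_le hpq fun u _ hu ↦ HM u (hu.trans hq)
  rw [e]
  refine (abs_add_le _ _).trans ?_
  rw [abs_mul, abs_mul, add_mul]
  refine add_le_add ?_ ?_
  · rw [mul_assoc]
    gcongr
    exact hi.trans (by gcongr; exact le_rpow_of_le_one' hpq' h1 hα0 hα)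
  · rw [mul_assoc]
    gcongr
    exact HK p q hpq hq h1

/-- The square of the stopped solution of `dy = (a / 2) y dt + (σ / 2) db` solves
`dx = a x dt + σ √x db`. -/
lemma sqrtEquationAt_stopZero_sq {α a σ x₀ : ℝ} (hα0 : 1 / 2 < α) (hα : α ≤ 1) (hσ : 0 < σ)
    (hx₀ : 0 < x₀) {b y : ℝ≥0 → ℝ} (hb0 : b 0 = 0) (hb : IsLocHolder α b) (hy : Continuous y)
    (hyeq : ∀ t : ℝ≥0, y t = √x₀ + a / 2 * (∫ u in (0 : ℝ)..t, y u.toNNReal) + σ / 2 * b t)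
    (T : ℝ≥0) : SqrtEquationAt a σ x₀ b (fun t ↦ stopZero y t ^ 2) T := by
  have hy0 : y 0 = √x₀ := by rw [hyeq 0, hb0]; simp
  have hypos : 0 < y 0 := by rw [hy0]; exact Real.sqrt_pos.2 hx₀
  have hα' : 0 < α := by linarith
  set z := stopZero y with hz
  have hzc : Continuous z := continuous_stopZero hy hypos
  have hznn : ∀ t, 0 ≤ z t := stopZero_nonneg hy hypos
  have hz0 : z 0 = √x₀ := by rw [hz, stopZero_zero hy hypos, hy0]
  have hz2c : Continuous fun t ↦ z t ^ 2 := hzc.pow 2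
  obtain ⟨K, hK, HK⟩ := ((IsLocHolder.of_ouEquation hα' hα hb hy hyeq).stopZero hα' hy hypos) T
  obtain ⟨L, hL, HL⟩ := hb T
  obtain ⟨M, hM, HM⟩ := exists_abs_le hzc T
  -- The only value of the integral that makes the equation true; what remains is that it is the
  -- Riemann–Stieltjes integral.
  set A : ℝ≥0 → ℝ := fun t ↦
    (z t ^ 2 - x₀ - a * ∫ s in (0 : ℝ)..t, z s.toNNReal ^ 2) / σ with hA
  refine ⟨A T, ?_, ?_⟩
  swap
  · simp only [hA]; field_simp; ring
  simp only [Real.sqrt_sq (hznn _)]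
  set C := (2 * K ^ 2 + |a| * M * K + σ * K * L + K ^ 2 + |a| * K ^ 2) / σ with hC
  refine hasRSIntegral_of_local (β := 2 * α) (C := C) (by linarith) (by positivity) ?_ ?_
  · simp [hA, hz0, Real.sq_sqrt hx₀.le]
  intro p ξ q hpξ hξq hqT h1
  have hpq := hpξ.trans hξq
  have hh0 : (0 : ℝ) ≤ (q : ℝ) - p := sub_nonneg.2 hpq
  have hAdiff : A q - A p = (z q ^ 2 - z p ^ 2 - a * ∫ s in (p : ℝ)..q, z s.toNNReal ^ 2) / σ := by
    rw [← integral_toNNReal_sub hz2c]; simp only [hA]; ring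
  have herr : z ξ * (b q - b p) - (A q - A p) = (σ * z ξ * (b q - b p) -
      (z q ^ 2 - z p ^ 2 - a * ∫ s in (p : ℝ)..q, z s.toNNReal ^ 2)) / σ := by
    rw [hAdiff]; field_simp
  rw [herr, abs_div, abs_of_pos hσ, hC, div_mul_eq_mul_div]
  gcongr
  set h : ℝ := (q : ℝ) - p with hh
  set w := h ^ α with hw
  have hw0 : 0 ≤ w := by positivity
  have hhw : h ≤ w := le_rpow_of_le_one' hh0 h1 hα' hα
  have hw2 : h ^ (2 * α) = w ^ 2 := by
    rw [mul_comm, Real.rpow_mul hh0, hw]; norm_cast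
  rw [hw2]
  have hosc : ∀ s t, p ≤ s → s ≤ q → p ≤ t → t ≤ q → |z s - z t| ≤ K * w := by
    intro s t hps hsq hpt htq
    wlog hst : t ≤ s generalizing s t
    · rw [abs_sub_comm]; exact this t s hpt htq hps hsq (le_of_not_ge hst)
    have e1 : (s : ℝ) ≤ q := hsq
    have e2 : (p : ℝ) ≤ t := hpt
    have e3 : (t : ℝ) ≤ s := hst
    refine (HK t s hst (hsq.trans hqT) (by linarith)).trans ?_
    have : (0 : ℝ) ≤ s - t := by linarith
    rw [hw]
    gcongr
    linarith
  rcases stopZero_eq_or (y := y) q with heq | hzq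
  · have hyz : ∫ s in (p : ℝ)..q, y s.toNNReal = ∫ s in (p : ℝ)..q, z s.toNNReal := by
      refine intervalIntegral.integral_congr fun s hs ↦ ?_
      rw [Set.uIcc_of_le (by exact_mod_cast hpq)] at hs
      exact (heq _ (Real.toNNReal_le_iff_le_coe.2 hs.2)).symm
    have hdb : σ * (b q - b p) = 2 * (z q - z p) - a * ∫ s in (p : ℝ)..q, z s.toNNReal := by
      rw [← hyz, ← integral_toNNReal_sub hy, hz, heq q le_rfl, heq p hpq, hyeq q, hyeq p]
      ring
    have hzi : Continuous fun s : ℝ ↦ z s.toNNReal := hzc.comp continuous_real_toNNReal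
    have hzi2 : Continuous fun s : ℝ ↦ z s.toNNReal ^ 2 := hzi.pow 2
    have hint : (∫ s in (p : ℝ)..q, z s.toNNReal ^ 2) - z ξ * ∫ s in (p : ℝ)..q, z s.toNNReal =
        ∫ s in (p : ℝ)..q, (z s.toNNReal ^ 2 - z ξ * z s.toNNReal) := by
      rw [intervalIntegral.integral_sub (hzi2.intervalIntegrable _ _)
        ((hzi.intervalIntegrable _ _).const_mul _), intervalIntegral.integral_const_mul]
    have hintb : |∫ s in (p : ℝ)..q, (z s.toNNReal ^ 2 - z ξ * z s.toNNReal)| ≤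
        (M * (K * w)) * h := by
      refine abs_integral_toNNReal_le (f := fun s ↦ z s ^ 2 - z ξ * z s) hpq fun s hps hsq ↦ ?_
      rw [show z s ^ 2 - z ξ * z s = z s * (z s - z ξ) by ring, abs_mul]
      exact mul_le_mul (HM s (hsq.trans hqT)) (hosc s ξ hps hsq hpξ hξq) (abs_nonneg _) hM
    -- Substituting the linear equation leaves a product of two increments of `z` and a drift error,
    -- each `O(w ^ 2)`.
    have hid : σ * z ξ * (b q - b p) -
        (z q ^ 2 - z p ^ 2 - a * ∫ s in (p : ℝ)..q, z s.toNNReal ^ 2) =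
        ((z ξ - z p) + (z ξ - z q)) * (z q - z p) +
          a * ∫ s in (p : ℝ)..q, (z s.toNNReal ^ 2 - z ξ * z s.toNNReal) := by
      rw [← hint]
      linear_combination z ξ * hdb
    rw [hid]
    have b1 := hosc ξ p hpξ hξq le_rfl hpq
    have b2 := hosc ξ q hpξ hξq hpq le_rfl
    have b3 := hosc q p hpq le_rfl le_rfl hpq
    calc _ ≤ (K * w + K * w) * (K * w) + |a| * (M * (K * w) * h) := by
          refine (abs_add_le _ _).trans ?_
          rw [abs_mul, abs_mul]
          gcongr
          exact (abs_add_le _ _).trans (by gcongr)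
      _ ≤ (K * w + K * w) * (K * w) + |a| * (M * (K * w) * w) := by gcongr
      _ = (2 * K ^ 2 + |a| * M * K) * w ^ 2 := by ring
      _ ≤ _ := by
          refine mul_le_mul_of_nonneg_right ?_ (by positivity)
          have : 0 ≤ σ * K * L + K ^ 2 + |a| * K ^ 2 := by positivity
          linarith
  -- Since `z q = 0`, `z` is at most `K * w` throughout `[p, q]`, so every term is `O(w ^ 2)` on its
  -- own.
  · have hzq' : z q = 0 := hzq
    have hzs : ∀ s, p ≤ s → s ≤ q → |z s| ≤ K * w := fun s hps hsq ↦ by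
      have := hosc s q hps hsq hpq le_rfl
      rwa [hzq', sub_zero] at this
    have hintb : |∫ s in (p : ℝ)..q, z s.toNNReal ^ 2| ≤ (K * w) ^ 2 * h := by
      refine abs_integral_toNNReal_le (f := fun s ↦ z s ^ 2) hpq fun s hps hsq ↦ ?_
      rw [abs_pow]
      gcongr
      exact hzs s hps hsq
    have hbL : |b q - b p| ≤ L * w := HL p q hpq hqT h1
    calc |σ * z ξ * (b q - b p) - (z q ^ 2 - z p ^ 2 - a * ∫ s in (p : ℝ)..q, z s.toNNReal ^ 2)|
        = |σ * z ξ * (b q - b p) + z p ^ 2 + a * ∫ s in (p : ℝ)..q, z s.toNNReal ^ 2| := by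
          rw [hzq']; congr 1; ring
      _ ≤ |σ * z ξ * (b q - b p)| + |z p ^ 2| + |a * ∫ s in (p : ℝ)..q, z s.toNNReal ^ 2| :=
          abs_add_three _ _ _
      _ ≤ σ * (K * w) * (L * w) + (K * w) ^ 2 + |a| * ((K * w) ^ 2 * 1) := by
          rw [abs_mul, abs_mul, abs_of_pos hσ, abs_pow, abs_mul a]
          have := hzs ξ hpξ hξq
          have := hzs p le_rfl hpq
          have : |∫ s in (p : ℝ)..q, z s.toNNReal ^ 2| ≤ (K * w) ^ 2 * 1 :=
            hintb.trans (by gcongr)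
          gcongr
      _ = (σ * K * L + K ^ 2 + |a| * K ^ 2) * w ^ 2 := by ring
      _ ≤ _ := by
          refine mul_le_mul_of_nonneg_right ?_ (by positivity)
          have : 0 ≤ 2 * K ^ 2 + |a| * M * K := by positivity
          linarith

/-! ### Dyadic chaining. -/

lemma natFloor_pow_two_succ (n : ℕ) (x : ℝ≥0) :
    ⌊2 ^ (n + 1) * x⌋₊ = 2 * ⌊2 ^ n * x⌋₊ ∨ ⌊2 ^ (n + 1) * x⌋₊ = 2 * ⌊2 ^ n * x⌋₊ + 1 := by
  have h1 : 2 * ⌊2 ^ n * x⌋₊ ≤ ⌊2 ^ (n + 1) * x⌋₊ := by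
    refine Nat.le_floor ?_
    rw [pow_succ', mul_assoc]
    push_cast
    gcongr
    exact Nat.floor_le zero_le
  have h2 : ⌊2 ^ (n + 1) * x⌋₊ < 2 * ⌊2 ^ n * x⌋₊ + 2 := by
    rw [Nat.floor_lt zero_le, pow_succ', mul_assoc]
    push_cast
    rw [show (2 : ℝ≥0) * (⌊2 ^ n * x⌋₊ : ℝ≥0) + 2 = 2 * (⌊2 ^ n * x⌋₊ + 1) by ring]
    gcongr
    exact Nat.lt_floor_add_one _
  omega

/-- The largest dyadic point of level `n` not exceeding `x`. -/
noncomputable def dyadicFloor (n : ℕ) (x : ℝ≥0) : ℝ≥0 := ⌊2 ^ n * x⌋₊ / 2 ^ n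

lemma dyadicFloor_le (n : ℕ) (x : ℝ≥0) : dyadicFloor n x ≤ x := by
  rw [dyadicFloor, div_le_iff₀' (by positivity)]
  exact Nat.floor_le zero_le

lemma le_dyadicFloor_add (n : ℕ) (x : ℝ≥0) : x ≤ dyadicFloor n x + (1 / 2) ^ n := by
  rw [dyadicFloor, one_div, inv_pow, ← one_div, ← add_div, le_div_iff₀' (by positivity)]
  exact (Nat.lt_floor_add_one _).le

lemma tendsto_dyadicFloor (x : ℝ≥0) : Tendsto (fun n ↦ dyadicFloor n x) atTop (𝓝 x) := by
  have h : Tendsto (fun n : ℕ ↦ x - (1 / 2 : ℝ≥0) ^ n) atTop (𝓝 x) := by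
    have : Tendsto (fun n : ℕ ↦ (1 / 2 : ℝ≥0) ^ n) atTop (𝓝 0) :=
      tendsto_pow_atTop_nhds_zero_of_lt_one zero_le (by rw [one_div]; exact inv_lt_one_of_one_lt₀ one_lt_two)
    simpa using (tendsto_const_nhds (x := x)).sub this
  exact tendsto_of_tendsto_of_tendsto_of_le_of_le h tendsto_const_nhds
    (fun n ↦ tsub_le_iff_right.2 (le_dyadicFloor_add n x)) fun n ↦ dyadicFloor_le n x

/-- Dyadic chaining: geometric decay of the dyadic increments gives Hölder continuity. -/
lemma abs_sub_le_of_dyadic {f : ℝ≥0 → ℝ} (hf : Continuous f) {N : ℕ} {α C : ℝ} (hα : 0 < α)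
    (hC : 0 ≤ C)
    (H : ∀ n, ∀ k < N * 2 ^ n, |f ((k + 1 : ℕ) / 2 ^ n) - f ((k : ℕ) / 2 ^ n)| ≤
      C * ((1 / 2 : ℝ) ^ α) ^ n) :
    ∃ K : ℝ, 0 ≤ K ∧ ∀ s t : ℝ≥0, s ≤ t → t ≤ N → (t : ℝ) - s ≤ 1 →
      |f t - f s| ≤ K * ((t : ℝ) - s) ^ α := by
  set ρ : ℝ := (1 / 2 : ℝ) ^ α with hρ
  have hρ0 : 0 < ρ := by positivity
  have hρ1 : ρ < 1 := Real.rpow_lt_one (by norm_num) (by norm_num) hα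
  have h1ρ : 0 < 1 - ρ := sub_pos.2 hρ1
  have hfl : ∀ (n : ℕ) (x : ℝ≥0), x ≤ N → ⌊2 ^ n * x⌋₊ ≤ N * 2 ^ n := fun n x hx ↦ by
    refine Nat.floor_le_of_le ?_
    push_cast
    rw [mul_comm]
    gcongr
  have hstep : ∀ x : ℝ≥0, x ≤ N → ∀ n, dist (f (dyadicFloor n x)) (f (dyadicFloor (n + 1) x)) ≤
      C * ρ ^ n := by
    intro x hx n
    have e : dyadicFloor n x = (2 * ⌊2 ^ n * x⌋₊ : ℕ) / 2 ^ (n + 1) := by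
      rw [dyadicFloor, pow_succ']
      push_cast
      rw [mul_div_mul_left _ _ two_ne_zero]
    rcases natFloor_pow_two_succ n x with h | h
    · have e' : dyadicFloor (n + 1) x = (2 * ⌊2 ^ n * x⌋₊ : ℕ) / 2 ^ (n + 1) := by
        rw [dyadicFloor, h]
      rw [e, e', dist_self]
      positivity
    · have e' : dyadicFloor (n + 1) x = (2 * ⌊2 ^ n * x⌋₊ + 1 : ℕ) / 2 ^ (n + 1) := by
        rw [dyadicFloor, h]
      have hk : 2 * ⌊2 ^ n * x⌋₊ < N * 2 ^ (n + 1) := by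
        have := hfl (n + 1) x hx
        omega
      rw [dist_comm, e, e', Real.dist_eq]
      refine (H (n + 1) _ hk).trans ?_
      exact mul_le_mul_of_nonneg_left (pow_le_pow_of_le_one hρ0.le hρ1.le n.le_succ) hC
  have happ : ∀ x : ℝ≥0, x ≤ N → ∀ n, dist (f (dyadicFloor n x)) (f x) ≤
      C * ρ ^ n / (1 - ρ) := fun x hx n ↦
    dist_le_of_le_geometric_of_tendsto ρ C hρ1 (hstep x hx)
      ((hf.tendsto x).comp (tendsto_dyadicFloor x)) n
  -- Two chaining tails from `s` and `t` to level `n` and one increment of that level; the division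
  -- by `ρ` comes from `ρ ^ (n + 1) ≤ (t - s) ^ α`.
  refine ⟨(2 * C / (1 - ρ) + C) / ρ, by positivity, fun s t hst htN h1 ↦ ?_⟩
  rcases hst.eq_or_lt with rfl | hlt
  · simp [Real.zero_rpow hα.ne']
  have hpos : 0 < (t : ℝ) - s := sub_pos.2 hlt
  obtain ⟨n, hn1, hn2⟩ := exists_nat_pow_near_of_lt_one hpos h1 (by norm_num : (0 : ℝ) < 1 / 2)
    (by norm_num)
  -- As `t - s ≤ (1 / 2) ^ n`, the level-`n` floors of `s` and `t` are equal or adjacent.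
  have hmid : |f (dyadicFloor n t) - f (dyadicFloor n s)| ≤ C * ρ ^ n := by
    have hle : ⌊2 ^ n * s⌋₊ ≤ ⌊2 ^ n * t⌋₊ := Nat.floor_le_floor (by gcongr)
    have hle' : ⌊2 ^ n * t⌋₊ ≤ ⌊2 ^ n * s⌋₊ + 1 := by
      have hts : t ≤ s + (1 / 2) ^ n := by
        rw [← NNReal.coe_le_coe]; push_cast; linarith
      rw [← Nat.floor_add_one zero_le]
      refine Nat.floor_le_floor ?_
      calc 2 ^ n * t ≤ 2 ^ n * (s + (1 / 2) ^ n) := by gcongr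
        _ = 2 ^ n * s + 1 := by rw [mul_add, ← mul_pow]; norm_num
    rcases (show ⌊2 ^ n * t⌋₊ = ⌊2 ^ n * s⌋₊ ∨ ⌊2 ^ n * t⌋₊ = ⌊2 ^ n * s⌋₊ + 1 by omega) with h | h
    · rw [dyadicFloor, dyadicFloor, h, sub_self, abs_zero]
      positivity
    · rw [dyadicFloor, dyadicFloor, h]
      refine H n _ ?_
      have := hfl n t htN
      omega
  have hs := happ s (hst.trans htN) n
  have ht := happ t htN n
  rw [Real.dist_eq, abs_le] at hs ht
  rw [abs_le] at hmid
  have hρn : ρ ^ n ≤ ((t : ℝ) - s) ^ α / ρ := by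
    rw [le_div_iff₀ hρ0, ← pow_succ, hρ, ← Real.rpow_natCast, ← Real.rpow_mul (by norm_num),
      mul_comm, Real.rpow_mul (by norm_num), Real.rpow_natCast]
    gcongr
  calc |f t - f s| ≤ (2 * C / (1 - ρ) + C) * ρ ^ n := by
        have e : (2 * C / (1 - ρ) + C) * ρ ^ n = 2 * (C * ρ ^ n / (1 - ρ)) + C * ρ ^ n := by ring
        rw [e, abs_le]
        constructor <;> linarith
    _ ≤ (2 * C / (1 - ρ) + C) * (((t : ℝ) - s) ^ α / ρ) := by gcongr
    _ = _ := by ring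

/-! ### Measurable versions and Hölder paths of fractional Brownian motion. -/

variable {Ω : Type*} [MeasurableSpace Ω] {P : Measure Ω}

/-- Paths are set to zero on a measurable null set, off which they are continuous and agree with
measurable modifications at a dense sequence of times; other times are limits. -/
lemma exists_measurable_continuous_version {B : ℝ≥0 → Ω → ℝ} (hm : ∀ t, AEMeasurable (B t) P)
    (hc : ∀ᵐ ω ∂P, Continuous fun t ↦ B t ω) :
    ∃ B' : ℝ≥0 → Ω → ℝ, (∀ t, Measurable (B' t)) ∧ (∀ ω, Continuous fun t ↦ B' t ω) ∧
      ∀ᵐ ω ∂P, ∀ t, B' t ω = B t ω := by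
  set d := TopologicalSpace.denseSeq ℝ≥0 with hd
  have hae : ∀ᵐ ω ∂P, (Continuous fun t ↦ B t ω) ∧ ∀ n, B (d n) ω = (hm (d n)).mk _ ω :=
    hc.and (ae_all_iff.2 fun n ↦ (hm (d n)).ae_eq_mk)
  set S := toMeasurable P {ω | ¬ ((Continuous fun t ↦ B t ω) ∧
    ∀ n, B (d n) ω = (hm (d n)).mk _ ω)} with hS
  have hSm : MeasurableSet S := measurableSet_toMeasurable _ _
  have hS0 : P S = 0 := by rw [hS, measure_toMeasurable]; exact hae
  have hgood : ∀ ω ∈ Sᶜ, (Continuous fun t ↦ B t ω) ∧ ∀ n, B (d n) ω = (hm (d n)).mk _ ω := by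
    intro ω hω
    by_contra h
    exact hω (subset_toMeasurable _ _ h)
  have hcont : ∀ ω, Continuous fun t ↦ Sᶜ.indicator (B t) ω := by
    intro ω
    by_cases hω : ω ∈ Sᶜ
    · simpa only [Set.indicator_of_mem hω] using (hgood ω hω).1
    · simpa only [Set.indicator_of_notMem hω] using continuous_const
  refine ⟨fun t ↦ Sᶜ.indicator (B t), fun t ↦ ?_, hcont, ?_⟩
  · obtain ⟨u, hu, hut⟩ := mem_closure_iff_seq_limit.1
      ((TopologicalSpace.denseRange_denseSeq ℝ≥0) t)
    refine measurable_of_tendsto_metrizable (f := fun n ↦ Sᶜ.indicator (B (u n))) (fun n ↦ ?_)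
      (tendsto_pi_nhds.2 fun ω ↦ ((hcont ω).tendsto t).comp hut)
    obtain ⟨m, hmn⟩ := hu n
    have : Sᶜ.indicator (B (u n)) = Sᶜ.indicator ((hm (d m)).mk _) := by
      refine Set.indicator_congr fun ω hω ↦ ?_
      rw [← (hgood ω hω).2 m, ← hmn]
    rw [this]
    exact ((hm (d m)).measurable_mk).indicator hSm.compl
  · have : ∀ᵐ ω ∂P, ω ∈ Sᶜ := measure_eq_zero_iff_ae_notMem.1 hS0
    filter_upwards [this] with ω hω t
    exact Set.indicator_of_mem hω _

/-- The covariances combine to variance `|t - s| ^ (2 * H)`. Writing the law as a scaled standard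
Gaussian yields all moments at once. -/
lemma IsFBM.map_sub {H : ℝ} {B : ℝ≥0 → Ω → ℝ} [IsProbabilityMeasure P] (hB : IsFBM P H B)
    (hH : 0 < H) (s t : ℝ≥0) :
    P.map (fun ω ↦ B t ω - B s ω) = (gaussianReal 0 1).map (|(t : ℝ) - s| ^ H * ·) := by
  have hg := hB.gaussian.hasGaussianLaw_fun_sub (s := t) (t := s)
  have hLt := (hB.gaussian.hasGaussianLaw_eval t).memLp_two
  have hLs := (hB.gaussian.hasGaussianLaw_eval s).memLp_two
  have hts : Integrable (fun ω ↦ B t ω * B s ω) P := hLt.integrable_mul hLs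
  have htt : Integrable (fun ω ↦ B t ω * B t ω) P := hLt.integrable_mul hLt
  have hss : Integrable (fun ω ↦ B s ω * B s ω) P := hLs.integrable_mul hLs
  have hmean : ∫ ω, (B t ω - B s ω) ∂P = 0 := by
    rw [integral_sub (hLt.integrable one_le_two) (hLs.integrable one_le_two), hB.centered,
      hB.centered, sub_zero]
  have hvar : Var[fun ω ↦ B t ω - B s ω; P] = (|(t : ℝ) - s| ^ H) ^ 2 := by
    rw [variance_of_integral_eq_zero hg.aemeasurable hmean]
    have : ∀ ω, (B t ω - B s ω) ^ 2 = B t ω * B t ω - 2 * (B t ω * B s ω) + B s ω * B s ω :=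
      fun ω ↦ by ring
    simp_rw [this]
    have hd : Integrable (fun ω ↦ B t ω * B t ω - 2 * (B t ω * B s ω)) P :=
      htt.sub (hts.const_mul 2)
    rw [integral_add hd hss, integral_sub htt (hts.const_mul 2),
      integral_const_mul, hB.covariance, hB.covariance, hB.covariance]
    rw [sub_self, sub_self, abs_zero, Real.zero_rpow (by positivity), ← Real.rpow_natCast,
      ← Real.rpow_mul (abs_nonneg _)]
    push_cast
    rw [mul_comm H 2]
    ring
  rw [hg.map_eq_gaussianReal, hmean, hvar, gaussianReal_map_const_mul, mul_zero]
  congr 1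
  rw [mul_one]
  exact Real.toNNReal_of_nonneg (sq_nonneg _)

lemma IsFBM.lintegral_enorm_sub_pow {H : ℝ} {B : ℝ≥0 → Ω → ℝ} [IsProbabilityMeasure P]
    (hB : IsFBM P H B) (hH : 0 < H) (s t : ℝ≥0) (q : ℕ) :
    ∫⁻ ω, ‖B t ω - B s ω‖ₑ ^ q ∂P =
      ENNReal.ofReal (|(t : ℝ) - s| ^ H) ^ q * ∫⁻ x, ‖x‖ₑ ^ q ∂(gaussianReal 0 1) := by
  have hg := hB.gaussian.hasGaussianLaw_fun_sub (s := t) (t := s)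
  have hmeas : Measurable fun x : ℝ ↦ ‖x‖ₑ ^ q := by fun_prop
  rw [← lintegral_map' (f := fun x : ℝ ↦ ‖x‖ₑ ^ q) hmeas.aemeasurable hg.aemeasurable,
    hB.map_sub hH, lintegral_map hmeas (by fun_prop), ← lintegral_const_mul _ hmeas]
  congr 1 with x
  rw [enorm_mul, mul_pow, Real.enorm_of_nonneg (by positivity)]

lemma lintegral_enorm_pow_gaussianReal_lt_top (q : ℕ) :
    ∫⁻ x, ‖x‖ₑ ^ q ∂(gaussianReal 0 1) < ⊤ := by
  rcases Nat.eq_zero_or_pos q with rfl | hq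
  · simp
  have := (memLp_id_gaussianReal (μ := 0) (v := 1) (q : ℝ≥0)).eLpNorm_lt_top
  rw [eLpNorm_lt_top_iff_lintegral_rpow_enorm_lt_top (by simpa using hq.ne') (by simp)] at this
  simpa using this

/-- Paths of fractional Brownian motion are Hölder continuous of every exponent less than `H`. -/
lemma IsFBM.ae_isLocHolder {H α : ℝ} {B : ℝ≥0 → Ω → ℝ} [IsProbabilityMeasure P]
    (hB : IsFBM P H B) (hα : 0 < α) (hαH : α < H) :
    ∀ᵐ ω ∂P, IsLocHolder α fun t ↦ B t ω := by
  have hH : 0 < H := hα.trans hαH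
  set ρ : ℝ := (1 / 2 : ℝ) ^ α with hρ
  set θ : ℝ := (1 / 2 : ℝ) ^ H with hθ
  have hρ0 : 0 < ρ := by positivity
  have hθ0 : 0 < θ := by positivity
  have hκ : θ / ρ < 1 := by
    rw [div_lt_one hρ0]
    exact Real.rpow_lt_rpow_of_exponent_gt (by norm_num) (by norm_num) hαH
  -- Level `n` has `N * 2 ^ n` increments, each with rescaled `q`-th moment proportional to `((θ /
  -- ρ) ^ q) ^ n`; `(θ / ρ) ^ q < 1 / 2` makes the series over `n` converge.
  obtain ⟨q, hq⟩ := exists_pow_lt_of_lt_one (by norm_num : (0 : ℝ) < 1 / 2) hκ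
  have hq0 : q ≠ 0 := by rintro rfl; norm_num at hq
  set c := ∫⁻ x, ‖x‖ₑ ^ q ∂(gaussianReal 0 1) with hc
  have hctop : c < ⊤ := lintegral_enorm_pow_gaussianReal_lt_top q
  set r : ℝ≥0∞ := ENNReal.ofReal (2 * (θ / ρ) ^ q) with hr
  have hr1 : r < 1 := by
    rw [hr, ENNReal.ofReal_lt_one]; linarith
  have hN : ∀ N : ℕ, ∀ᵐ ω ∂P, ∃ C : ℝ, 0 ≤ C ∧ ∀ n, ∀ k < N * 2 ^ n,
      |B ((k + 1 : ℕ) / 2 ^ n) ω - B ((k : ℕ) / 2 ^ n) ω| ≤ C * ρ ^ n := by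
    intro N
    set F : ℕ → Ω → ℝ≥0∞ := fun n ω ↦ ∑ k ∈ Finset.range (N * 2 ^ n),
      ENNReal.ofReal ((ρ⁻¹ ^ n) ^ q) *
        ‖B ((k + 1 : ℕ) / 2 ^ n) ω - B ((k : ℕ) / 2 ^ n) ω‖ₑ ^ q with hF
    have hterm : ∀ n k : ℕ, AEMeasurable (fun ω ↦ ENNReal.ofReal ((ρ⁻¹ ^ n) ^ q) *
        ‖B ((k + 1 : ℕ) / 2 ^ n) ω - B ((k : ℕ) / 2 ^ n) ω‖ₑ ^ q) P := fun n k ↦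
      (((hB.gaussian.hasGaussianLaw_fun_sub (s := (k + 1 : ℕ) / 2 ^ n)
        (t := (k : ℕ) / 2 ^ n)).aemeasurable.enorm).pow_const q).const_mul _
    have hFm : ∀ n, AEMeasurable (F n) P := fun n ↦
      Finset.aemeasurable_fun_sum _ fun k _ ↦ hterm n k
    have hFint : ∀ n, ∫⁻ ω, F n ω ∂P = N * c * r ^ n := by
      intro n
      rw [hF, lintegral_finsetSum' _ fun k _ ↦ hterm n k]
      have : ∀ k : ℕ, ∫⁻ ω, ENNReal.ofReal ((ρ⁻¹ ^ n) ^ q) *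
          ‖B ((k + 1 : ℕ) / 2 ^ n) ω - B ((k : ℕ) / 2 ^ n) ω‖ₑ ^ q ∂P =
          ENNReal.ofReal (((θ / ρ) ^ q) ^ n) * c := by
        intro k
        rw [lintegral_const_mul' _ _ ENNReal.ofReal_ne_top, hB.lintegral_enorm_sub_pow hH,
          ← mul_assoc, ← ENNReal.ofReal_pow (by positivity), ← ENNReal.ofReal_mul (by positivity)]
        congr 2
        have e : |(((k + 1 : ℕ) / 2 ^ n : ℝ≥0) : ℝ) - ((k : ℕ) / 2 ^ n : ℝ≥0)| = (1 / 2) ^ n := by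
          push_cast
          rw [← sub_div, add_sub_cancel_left, abs_of_pos (by positivity), one_div_pow]
        rw [e, hθ, ← Real.rpow_natCast (1 / 2 : ℝ) n, ← Real.rpow_mul (by norm_num), mul_comm (n : ℝ) H,
          Real.rpow_mul (by norm_num), Real.rpow_natCast, ← mul_pow, ← mul_pow, ← pow_mul, ← pow_mul,
          mul_comm n q]
        congr 1
        ring
      rw [Finset.sum_congr rfl fun k _ ↦ this k, Finset.sum_const, Finset.card_range, nsmul_eq_mul,
        hr, ENNReal.ofReal_mul zero_le_two, mul_pow, ENNReal.ofReal_pow (by positivity),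
        ENNReal.ofReal_ofNat]
      push_cast
      ring
    have hfin : ∫⁻ ω, ∑' n, F n ω ∂P ≠ ⊤ := by
      rw [lintegral_tsum hFm]
      simp_rw [hFint]
      rw [ENNReal.tsum_mul_left, ENNReal.tsum_geometric]
      refine ENNReal.mul_ne_top (ENNReal.mul_ne_top (ENNReal.natCast_ne_top N) hctop.ne) ?_
      exact ENNReal.inv_ne_top.2 (tsub_pos_of_lt hr1).ne'
    filter_upwards [ae_lt_top' (AEMeasurable.tsum hFm) hfin] with ω hω
    set S := ∑' n, F n ω with hS
    -- The maximum with `1` avoids `q`-th roots: a number at least `1` is at most its `q`-th power.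
    refine ⟨max 1 S.toReal, by positivity, fun n k hk ↦ ?_⟩
    set D := B ((k + 1 : ℕ) / 2 ^ n) ω - B ((k : ℕ) / 2 ^ n) ω with hD
    have h1 : ENNReal.ofReal ((ρ⁻¹ ^ n) ^ q) * ‖D‖ₑ ^ q ≤ S :=
      (Finset.single_le_sum (f := fun k : ℕ ↦ ENNReal.ofReal ((ρ⁻¹ ^ n) ^ q) *
        ‖B ((k + 1 : ℕ) / 2 ^ n) ω - B ((k : ℕ) / 2 ^ n) ω‖ₑ ^ q) (fun _ _ ↦ zero_le)
        (Finset.mem_range.2 hk)).trans (ENNReal.le_tsum n)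
    have h2 : (ρ⁻¹ ^ n * |D|) ^ q ≤ S.toReal := by
      rw [← ENNReal.ofReal_le_iff_le_toReal hω.ne]
      refine le_trans (le_of_eq ?_) h1
      rw [mul_pow, ENNReal.ofReal_mul (by positivity), ENNReal.ofReal_pow (abs_nonneg D),
        ← Real.enorm_eq_ofReal_abs]
    have h3 : ρ⁻¹ ^ n * |D| ≤ max 1 S.toReal := by
      by_contra! hlt
      have : max 1 S.toReal ≤ (max 1 S.toReal) ^ q := le_self_pow₀ (le_max_left _ _) hq0
      have h4 : (max 1 S.toReal) ^ q < (ρ⁻¹ ^ n * |D|) ^ q := by gcongr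
      linarith [le_max_right 1 S.toReal]
    rwa [inv_pow, inv_mul_le_iff₀ (by positivity), mul_comm] at h3
  filter_upwards [ae_all_iff.2 hN, hB.continuous_paths] with ω hω hcont T
  obtain ⟨N, hTN⟩ := exists_nat_ge T
  obtain ⟨C, hC, HC⟩ := hω N
  obtain ⟨K, hK, HK⟩ := abs_sub_le_of_dyadic hcont hα hC HC
  exact ⟨K, hK, fun s t hst ht ↦ HK s t hst (ht.trans hTN)⟩

lemma IsFBM.ae_zero {H : ℝ} {B : ℝ≥0 → Ω → ℝ} [IsProbabilityMeasure P] (hB : IsFBM P H B)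
    (hH : 0 < H) : ∀ᵐ ω ∂P, B 0 ω = 0 := by
  have hL := (hB.gaussian.hasGaussianLaw_eval 0).memLp_two
  have h := hB.covariance 0 0
  simp only [NNReal.coe_zero, sub_self, abs_zero, Real.zero_rpow (by positivity : 2 * H ≠ 0),
    add_zero, mul_zero] at h
  have := (integral_eq_zero_iff_of_nonneg (fun ω ↦ mul_self_nonneg (B 0 ω))
    (hL.integrable_mul hL)).1 h
  filter_upwards [this] with ω hω
  exact mul_self_eq_zero.1 hω

/-! ### Measurability of the processes and conclusion. -/

/-- Positivity on the compact interval `[0, t]` is a uniform lower bound, which can be tested on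
countably many times; this makes the event measurable. -/
lemma lt_hitZero_iff {y : ℝ≥0 → ℝ} (hy : Continuous y) (h0 : 0 < y 0) (t : ℝ≥0) :
    (t : ℝ≥0∞) < hitZero y ↔ ∃ m : ℕ, ∀ n : ℕ,
      1 / ((m : ℝ) + 1) ≤ y (min (TopologicalSpace.denseSeq ℝ≥0 n) t) := by
  constructor
  · intro h
    obtain ⟨s, hs, hmin⟩ := (isCompact_Icc (a := (0 : ℝ≥0)) (b := t)).exists_isMinOn
      ⟨0, by simp⟩ hy.continuousOn
    have hpos : 0 < y s := pos_of_lt_hitZero hy h0 (lt_of_le_of_lt (by exact_mod_cast hs.2) h)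
    obtain ⟨m, hm⟩ := exists_nat_one_div_lt hpos
    exact ⟨m, fun n ↦ hm.le.trans (hmin (⟨zero_le, min_le_right _ _⟩ : _ ∈ Set.Icc 0 t))⟩
  · rintro ⟨m, hm⟩
    by_contra! hle
    obtain ⟨r, -, hyr, hreq⟩ := exists_hitZero_eq hy h0.ne' (hle.trans_lt ENNReal.coe_lt_top).ne
    rw [hreq, ENNReal.coe_le_coe] at hle
    have := (TopologicalSpace.denseRange_denseSeq ℝ≥0).induction_on
      (p := fun s ↦ 1 / ((m : ℝ) + 1) ≤ y (min s t)) r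
      (isClosed_le continuous_const (by fun_prop)) hm
    rw [min_eq_left hle, hyr] at this
    exact absurd this (not_le.2 (by positivity))

lemma measurable_ouPath (c s y₀ : ℝ) {B : ℝ≥0 → Ω → ℝ} (hm : ∀ t, Measurable (B t))
    (hc : ∀ ω, Continuous fun t ↦ B t ω) (t : ℝ≥0) :
    Measurable fun ω ↦ ouPath c s y₀ (fun r ↦ B r ω) t := by
  have hu : Measurable (Function.uncurry B) := measurable_uncurry_of_continuous_of_measurable hc hm
  have hj : Measurable (Function.uncurry fun (ω : Ω) (u : ℝ) ↦
      Real.exp (-c * u) * B u.toNNReal ω) := by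
    have h1 : Measurable fun p : Ω × ℝ ↦ Function.uncurry B (p.2.toNNReal, p.1) :=
      hu.comp (measurable_snd.real_toNNReal.prodMk measurable_fst)
    have h2 : Measurable fun p : Ω × ℝ ↦ Real.exp (-c * p.2) := by fun_prop
    exact h2.mul h1
  have hint : Measurable fun ω ↦ ∫ u in (0 : ℝ)..t, Real.exp (-c * u) * B u.toNNReal ω := by
    simp_rw [intervalIntegral.integral_of_le t.coe_nonneg]
    exact (hj.stronglyMeasurable.integral_prod_right
      (ν := volume.restrict (Set.Ioc 0 (t : ℝ)))).measurable
  exact ((hint.const_mul _).const_add _).const_mul _ |>.add ((hm t).const_mul s)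

lemma aemeasurable_stopZero {Y : ℝ≥0 → Ω → ℝ} (hm : ∀ t, Measurable (Y t))
    (hc : ∀ ω, Continuous fun t ↦ Y t ω) (h0 : ∀ᵐ ω ∂P, 0 < Y 0 ω) (t : ℝ≥0) :
    AEMeasurable (fun ω ↦ stopZero (fun r ↦ Y r ω) t) P := by
  set E : Set Ω := {ω | ∃ m : ℕ, ∀ n : ℕ,
    1 / ((m : ℝ) + 1) ≤ Y (min (TopologicalSpace.denseSeq ℝ≥0 n) t) ω} with hE
  have hEm : MeasurableSet E := by
    simp only [hE, Set.ofPred_exists, Set.ofPred_forall]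
    exact MeasurableSet.iUnion fun m ↦ MeasurableSet.iInter fun n ↦
      measurableSet_le measurable_const (hm _)
  refine ⟨E.indicator (Y t), (hm t).indicator hEm, ?_⟩
  filter_upwards [h0] with ω hω
  by_cases h : (t : ℝ≥0∞) < hitZero fun r ↦ Y r ω
  · have hωE : ω ∈ E := (lt_hitZero_iff (hc ω) hω t).1 h
    rw [Set.indicator_of_mem hωE]
    exact if_pos h
  · have hωE : ω ∉ E := fun h' ↦ h ((lt_hitZero_iff (hc ω) hω t).2 h')
    rw [Set.indicator_of_notMem hωE]
    exact if_neg h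

/-- Measurability and continuity for every `ω` are recorded because `aemeasurable_stopZero` needs
them. -/
lemma exists_isFOU {B : ℝ≥0 → Ω → ℝ} (hm : ∀ t, AEMeasurable (B t) P)
    (hc : ∀ᵐ ω ∂P, Continuous fun t ↦ B t ω) (c s y₀ : ℝ) :
    ∃ Y : ℝ≥0 → Ω → ℝ, IsFOU P c s y₀ B Y ∧ (∀ t, Measurable (Y t)) ∧
      ∀ ω, Continuous fun t ↦ Y t ω := by
  obtain ⟨B', hm', hc', hae⟩ := exists_measurable_continuous_version hm hc
  have hYm := measurable_ouPath c s y₀ hm' hc'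
  have hYc : ∀ ω, Continuous fun t ↦ ouPath c s y₀ (fun r ↦ B' r ω) t := fun ω ↦
    continuous_ouPath c s y₀ (hc' ω)
  refine ⟨fun t ω ↦ ouPath c s y₀ (fun r ↦ B' r ω) t, ⟨fun t ↦ (hYm t).aemeasurable,
    .of_forall hYc, ?_⟩, hYm, hYc⟩
  filter_upwards [hae] with ω hω t
  rw [← hω t]
  exact ouPath_eq c s y₀ (hc' ω) t

lemma IsFBM.exists_isSolution [IsProbabilityMeasure P] {H a σ x₀ : ℝ} (hH : 1 / 2 < H)
    (hH1 : H ≤ 1) (hσ : 0 < σ) (hx₀ : 0 < x₀) {B : ℝ≥0 → Ω → ℝ} (hB : IsFBM P H B) :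
    ∃ X : ℝ≥0 → Ω → ℝ, IsSolution P a σ x₀ B X := by
  obtain ⟨Y, hY, hYm, hYc⟩ := exists_isFOU hB.gaussian.aemeasurable hB.continuous_paths
    (a / 2) (σ / 2) (√x₀)
  obtain ⟨α, hα, hαH⟩ := exists_between hH
  have hB0 := hB.ae_zero (by linarith)
  have hY0 : ∀ᵐ ω ∂P, Y 0 ω = √x₀ := by
    filter_upwards [hY.equation, hB0] with ω hω h0
    rw [hω 0, h0]
    simp
  have hY0' : ∀ᵐ ω ∂P, 0 < Y 0 ω := by
    filter_upwards [hY0] with ω hω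
    rw [hω]
    exact Real.sqrt_pos.2 hx₀
  refine ⟨fun t ω ↦ stopZero (fun r ↦ Y r ω) t ^ 2, ⟨fun t ↦
    (aemeasurable_stopZero hYm hYc hY0' t).pow_const 2, ?_, .of_forall fun ω t ↦ sq_nonneg _,
    ?_, ?_⟩⟩
  · filter_upwards [hY0'] with ω hω
    exact (continuous_stopZero (hYc ω) hω).pow 2
  · filter_upwards [hY0, hY0'] with ω h1 h2
    rw [stopZero_zero (hYc ω) h2, h1, Real.sq_sqrt hx₀.le]
  · filter_upwards [hY.equation, hB0, hB.ae_isLocHolder (by linarith) hαH] with ω h1 h2 h3 T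
    exact sqrtEquationAt_stopZero_sq hα (by linarith) hσ hx₀ h2 h3 (hYc ω) h1 T

lemma IsFBM.solution_eq_sq [IsProbabilityMeasure P] {H a σ x₀ : ℝ} (hH : 0 < H) (hx₀ : 0 < x₀)
    {B X Y : ℝ≥0 → Ω → ℝ} (hB : IsFBM P H B) (hX : IsSolutionUntilZero P a σ x₀ B X)
    (hY : IsFOU P (a / 2) (σ / 2) (√x₀) B Y) :
    ∀ᵐ ω ∂P, hitZero (fun s ↦ X s ω) = hitZero (fun s ↦ Y s ω) ∧
      ∀ t : ℝ≥0, (t : ℝ≥0∞) < hitZero (fun s ↦ X s ω) → X t ω = Y t ω ^ 2 := by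
  filter_upwards [hB.ae_zero hH, hX.continuous_paths, hX.initial, hX.equation,
    hY.continuous_paths, hY.equation] with ω h1 h2 h3 h4 h5 h6
  exact eq_sq_of_sqrtEquationAt hx₀ h1 h2 h3 h5 h4 h6

end FCIR

theorem mainTheorem6 {Ω : Type*} [MeasurableSpace Ω] (P : Measure Ω) [IsProbabilityMeasure P]
    (H : ℝ) (hH : 2 / 3 < H) (hH1 : H < 1) (a σ x₀ : ℝ) (hσ : 0 < σ) (hx₀ : 0 < x₀)
    (B : ℝ≥0 → Ω → ℝ) (hB : FCIR.IsFBM P H B) :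
    -- a solution exists (on the whole half-line)
    (∃ X : ℝ≥0 → Ω → ℝ, FCIR.IsSolution P a σ x₀ B X) ∧
    -- solutions are unique until the first zero
    (∀ X X' : ℝ≥0 → Ω → ℝ,
      FCIR.IsSolutionUntilZero P a σ x₀ B X → FCIR.IsSolutionUntilZero P a σ x₀ B X' →
      ∀ᵐ ω ∂P, FCIR.hitZero (fun s ↦ X s ω) = FCIR.hitZero (fun s ↦ X' s ω) ∧
        ∀ t : ℝ≥0, (t : ℝ≥0∞) < FCIR.hitZero (fun s ↦ X s ω) → X t ω = X' t ω) ∧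
    -- the fractional Ornstein–Uhlenbeck process exists
    (∃ Y : ℝ≥0 → Ω → ℝ, FCIR.IsFOU P (a / 2) (σ / 2) (√x₀) B Y) ∧
    -- until its first zero, the solution is the square of that process
    (∀ X Y : ℝ≥0 → Ω → ℝ,
      FCIR.IsSolutionUntilZero P a σ x₀ B X → FCIR.IsFOU P (a / 2) (σ / 2) (√x₀) B Y →
      ∀ᵐ ω ∂P, FCIR.hitZero (fun s ↦ X s ω) = FCIR.hitZero (fun s ↦ Y s ω) ∧
        ∀ t : ℝ≥0, (t : ℝ≥0∞) < FCIR.hitZero (fun s ↦ X s ω) → X t ω = Y t ω ^ 2) := by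
  obtain ⟨Y, hY, -⟩ := FCIR.exists_isFOU hB.gaussian.aemeasurable hB.continuous_paths
    (a / 2) (σ / 2) (√x₀)
  have hH0 : 0 < H := by linarith
  refine ⟨hB.exists_isSolution (by linarith) hH1.le hσ hx₀, fun X X' hX hX' ↦ ?_, ⟨Y, hY⟩,
    fun X Y hX hY ↦ hB.solution_eq_sq hH0 hx₀ hX hY⟩
  filter_upwards [hB.solution_eq_sq hH0 hx₀ hX hY, hB.solution_eq_sq hH0 hx₀ hX' hY]
    with ω h h'
  refine ⟨h.1.trans h'.1.symm, fun t ht ↦ ?_⟩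
  rw [h.2 t ht, h'.2 t (by rwa [h'.1, ← h.1])]
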